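/- Consider the class of equations $u_t+uu_x+h(t)u_{xxt}=l(t)$, where $h$ and $l$ are arbitrary real smooth functions of $t$ on a nonempty open interval $I$ and $h\neq0$ everywhere on $I$. The maximal Lie invariance algebra $A^{\max}$ of such an equation consists of the smooth vector fields $\tau\partial_t+\xi\partial_x+\eta\partial_u$ (with $\tau,\xi,\eta$ functions of $(t,x,u)\in I\times\mathbb R^2$) whose third prolongation annihilates the equation on the submanifold defined by the equation in the third-order jet space. The kernel is the common part of the algebras $A^{\max}$ over all equations of the class (with the same $I$), and an equation has a Lie symmetry extension if its $A^{\max}$ is strictly larger than the kernel. Let $G^\sim_3$ be the usual equivalence group of the class, that is, the group of the transformations $$\tilde t=\tfrac{\delta_1}{\delta_3}t+\delta_0,\quad \tilde x=\delta_1x+\delta_2,\quad \tilde u=\delta_3u,\quad \tilde h=\delta_1^2h,\quad \tilde l=\tfrac{\delta_3^2}{\delta_1}l,$$ where $\delta_0,\dots,\delta_3$ are arbitrary real constants with $\delta_1\delta_3\neq0$. Then the kernel is the one-dimensional algebra $\langle\partial_x\rangle$. An equation of the class has a Lie symmetry extension if and only if it is $G^\sim_3$-equivalent to an equation of one of the following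 four cases, and equations from two different cases are never $G^\sim_3$-equivalent. In each case $A^{\max}$ has the basis indicated, for every equation of the case. 1. $h=\varepsilon|t|^\rho$, $l=\lambda|t|^{(\rho-4)/2}$ on an interval not containing $0$, with $(\rho,\lambda)\neq(0,0)$: $\ \partial_x,\ 2t\partial_t+\rho x\partial_x+(\rho-2)u\partial_u$; 2. $h=\varepsilon e^t$, $l=\lambda e^{t/2}$: $\ \partial_x,\ 2\partial_t+x\partial_x+u\partial_u$; 3. $h=\varepsilon$, $l=1$: $\ \partial_x,\ \partial_t$; 4. $h=\varepsilon$, $l=0$: $\ \partial_x,\ \partial_t,\ t\partial_t-u\partial_u$. Here $\rho$ and $\lambda$ are real constants and $\varepsilon=\pm1$. -/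

import Mathlib

open scoped ContDiff

namespace BBM

/-! ### Equations of the class `u_t + u u_x + h(t) u_xxt = l(t)`, `h ≠ 0` -/

/-- Partial derivative with respect to the first variable `t`. -/
noncomputable def dt (u : ℝ → ℝ → ℝ) : ℝ → ℝ → ℝ := fun t x => deriv (fun s => u s x) t

/-- Partial derivative with respect to the second variable `x`. -/
noncomputable def dx (u : ℝ → ℝ → ℝ) : ℝ → ℝ → ℝ := fun t x => deriv (fun y => u t y) x

/-- The differential function `u_t + u u_x + h(t) u_xxt - l(t)` evaluated along `u`. -/
noncomputable def residual (h l : ℝ → ℝ) (u : ℝ → ℝ → ℝ) (t x : ℝ) : ℝ :=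
  dt u t x + u t x * dx u t x + h t * dt (dx (dx u)) t x - l t

/-- Nonempty open intervals, bounded or not: the ranges of the variable `t`. -/
structure IsOpenInterval (I : Set ℝ) : Prop where
  isOpen : IsOpen I
  ordConnected : I.OrdConnected
  nonempty : I.Nonempty

/-- The pair `(h, l)` of arbitrary elements determines an equation of the class, with `t` ranging
over the open interval `I`. Only the values of `h` and `l` on `I` matter. -/
structure InClass (I : Set ℝ) (h l : ℝ → ℝ) : Prop where
  interval : IsOpenInterval I
  smooth_h : ContDiffOn ℝ ∞ h I
  smooth_l : ContDiffOn ℝ ∞ l I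
  h_ne_zero : ∀ t ∈ I, h t ≠ 0

/-! ### Lie symmetries -/

/-- Vector fields `τ ∂_t + ξ ∂_x + η ∂_u` on `I × ℝ × ℝ`, the space of the variables `(t, x, u)`;
the value at a point is the triple `(τ, ξ, η)` of components. -/
abbrev VectorField (I : Set ℝ) : Type := I × ℝ × ℝ → ℝ × ℝ × ℝ

/-- The characteristic `η - τ u_t - ξ u_x` of `τ ∂_t + ξ ∂_x + η ∂_u`, evaluated along `u`. -/
noncomputable def characteristic (τ ξ η : ℝ × ℝ × ℝ → ℝ) (u : ℝ → ℝ → ℝ) : ℝ → ℝ → ℝ :=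
  fun t x => η (t, x, u t x) - τ (t, x, u t x) * dt u t x - ξ (t, x, u t x) * dx u t x

/-- Coefficient `D_t Q + τ u_tt + ξ u_tx` of `∂/∂u_t` in the prolongation, evaluated along `u`. -/
noncomputable def prolT (τ ξ η : ℝ × ℝ × ℝ → ℝ) (u : ℝ → ℝ → ℝ) (t x : ℝ) : ℝ :=
  dt (characteristic τ ξ η u) t x
    + τ (t, x, u t x) * dt (dt u) t x + ξ (t, x, u t x) * dx (dt u) t x

/-- Coefficient `D_x Q + τ u_xt + ξ u_xx` of `∂/∂u_x` in the prolongation, evaluated along `u`. -/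
noncomputable def prolX (τ ξ η : ℝ × ℝ × ℝ → ℝ) (u : ℝ → ℝ → ℝ) (t x : ℝ) : ℝ :=
  dx (characteristic τ ξ η u) t x
    + τ (t, x, u t x) * dt (dx u) t x + ξ (t, x, u t x) * dx (dx u) t x

/-- Coefficient `D_t D_x² Q + τ u_xxtt + ξ u_xxtx` of `∂/∂u_xxt` in the prolongation, evaluated
along `u`. -/
noncomputable def prolXXT (τ ξ η : ℝ × ℝ × ℝ → ℝ) (u : ℝ → ℝ → ℝ) (t x : ℝ) : ℝ :=
  dt (dx (dx (characteristic τ ξ η u))) t x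
    + τ (t, x, u t x) * dt (dt (dx (dx u))) t x + ξ (t, x, u t x) * dx (dt (dx (dx u))) t x

/-- The third prolongation of `τ ∂_t + ξ ∂_x + η ∂_u` applied to
`u_t + u u_x + h(t) u_xxt - l(t)`, evaluated along `u`. -/
noncomputable def prolongationAction (h l : ℝ → ℝ) (τ ξ η : ℝ × ℝ × ℝ → ℝ)
    (u : ℝ → ℝ → ℝ) (t x : ℝ) : ℝ :=
  τ (t, x, u t x) * (deriv h t * dt (dx (dx u)) t x - deriv l t)
    + η (t, x, u t x) * dx u t x
    + prolT τ ξ η u t x + u t x * prolX τ ξ η u t x + h t * prolXXT τ ξ η u t x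

/-- The infinitesimal invariance criterion: the third prolongation annihilates the equation at
every point of the submanifold that the equation defines in the third-order jet space. Every jet
over a point of `I × ℝ` is the jet of some smooth function `u` on the plane. -/
def InvarianceCriterion (I : Set ℝ) (h l : ℝ → ℝ) (τ ξ η : ℝ × ℝ × ℝ → ℝ) : Prop :=
  ∀ u : ℝ → ℝ → ℝ, ContDiff ℝ ∞ (Function.uncurry u) →
    ∀ t ∈ I, ∀ x : ℝ, residual h l u t x = 0 → prolongationAction h l τ ξ η u t x = 0

/-- The maximal Lie invariance algebra `A^max` of the equation with arbitrary elements `(h, l)`: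
all smooth vector fields on `I × ℝ × ℝ` that satisfy the infinitesimal invariance criterion. -/
def Amax (I : Set ℝ) (h l : ℝ → ℝ) : Set (VectorField I) :=
  {Γ | ∃ τ ξ η : ℝ × ℝ × ℝ → ℝ,
    ContDiffOn ℝ ∞ τ (I ×ˢ Set.univ) ∧ ContDiffOn ℝ ∞ ξ (I ×ˢ Set.univ) ∧
    ContDiffOn ℝ ∞ η (I ×ˢ Set.univ) ∧ InvarianceCriterion I h l τ ξ η ∧
    ∀ p : I × ℝ × ℝ, Γ p =
      (τ ((p.1 : ℝ), p.2.1, p.2.2), ξ ((p.1 : ℝ), p.2.1, p.2.2), η ((p.1 : ℝ), p.2.1, p.2.2))}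

/-- The kernel of the maximal Lie invariance algebras: their common part over the class. -/
def kernelAlgebra (I : Set ℝ) : Set (VectorField I) :=
  {Γ | ∀ h l : ℝ → ℝ, InClass I h l → Γ ∈ Amax I h l}

/-- The equation admits a Lie symmetry extension: `A^max` is strictly larger than the kernel. -/
def HasExtension (I : Set ℝ) (h l : ℝ → ℝ) : Prop := kernelAlgebra I ⊂ Amax I h l

/-- The vector fields `b` form a basis of the real vector space `A`. -/
def IsBasisOf {I : Set ℝ} {n : ℕ} (b : Fin n → VectorField I) (A : Set (VectorField I)) : Prop :=
  LinearIndependent ℝ b ∧ A = (Submodule.span ℝ (Set.range b) : Set (VectorField I))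

/-- `∂_t` -/
def fieldT (I : Set ℝ) : VectorField I := fun _ => (1, 0, 0)

/-- `∂_x` -/
def fieldX (I : Set ℝ) : VectorField I := fun _ => (0, 1, 0)

/-- `2t ∂_t + ρ x ∂_x + (ρ - 2) u ∂_u` -/
def fieldPower (I : Set ℝ) (ρ : ℝ) : VectorField I :=
  fun p => (2 * (p.1 : ℝ), ρ * p.2.1, (ρ - 2) * p.2.2)

/-- `2 ∂_t + x ∂_x + u ∂_u` -/
def fieldExp (I : Set ℝ) : VectorField I := fun p => (2, p.2.1, p.2.2)

/-- `t ∂_t - u ∂_u` -/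
def fieldScale (I : Set ℝ) : VectorField I := fun p => ((p.1 : ℝ), 0, -p.2.2)

/-! ### The equivalence group -/

/-- Elements of the usual equivalence group of the class: the transformations
`t' = (δ₁/δ₃) t + δ₀`, `x' = δ₁ x + δ₂`, `u' = δ₃ u`, `h' = δ₁² h`, `l' = (δ₃²/δ₁) l`. -/
structure EquivTransf where
  δ₀ : ℝ
  δ₁ : ℝ
  δ₂ : ℝ
  δ₃ : ℝ
  δ₁_ne_zero : δ₁ ≠ 0
  δ₃_ne_zero : δ₃ ≠ 0

namespace EquivTransf

noncomputable def mapT (g : EquivTransf) (t : ℝ) : ℝ := g.δ₁ / g.δ₃ * t + g.δ₀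
noncomputable def mapX (g : EquivTransf) (x : ℝ) : ℝ := g.δ₁ * x + g.δ₂
noncomputable def mapU (g : EquivTransf) (u : ℝ) : ℝ := g.δ₃ * u
noncomputable def mapH (g : EquivTransf) (a : ℝ) : ℝ := g.δ₁ ^ 2 * a
noncomputable def mapL (g : EquivTransf) (b : ℝ) : ℝ := g.δ₃ ^ 2 / g.δ₁ * b

/-- `g` maps the equation with arbitrary elements `(h, l)` on `I` to the one with `(h', l')` on
`I'`. -/
def Maps (g : EquivTransf) (I : Set ℝ) (h l : ℝ → ℝ) (I' : Set ℝ) (h' l' : ℝ → ℝ) : Prop :=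
  I' = g.mapT '' I ∧ ∀ t ∈ I, h' (g.mapT t) = g.mapH (h t) ∧ l' (g.mapT t) = g.mapL (l t)

/-- Justification of the definition: if the graph of `u'` is the image of the graph of `u` under
`g`, then `u'` satisfies the transformed equation exactly where `u` satisfies the original one. -/
theorem Maps.residual_eq {g : EquivTransf} {I I' : Set ℝ} {h l h' l' : ℝ → ℝ}
    (hg : g.Maps I h l I' h' l') {u u' : ℝ → ℝ → ℝ}
    (hu : ∀ t x, u' (g.mapT t) (g.mapX x) = g.mapU (u t x)) (t : ℝ) (ht : t ∈ I) (x : ℝ) :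
    residual h' l' u' (g.mapT t) (g.mapX x) = g.δ₃ ^ 2 / g.δ₁ * residual h l u t x := by
  obtain ⟨d0, d1, d2, d3, h1, h3⟩ := g
  obtain ⟨hh, hl⟩ := hg.2 t ht
  simp only [mapT, mapX, mapU, mapH, mapL] at *
  have e : u = fun t x => d3⁻¹ * u' (d1 / d3 * t + d0) (d1 * x + d2) := by
    funext t x; rw [hu]; field_simp
  have key : ∀ (w : ℝ → ℝ) (a b y : ℝ),
      deriv (fun y => w (a * y + b)) y = a * deriv w (a * y + b) := fun w a b y => by
    rw [deriv_comp_mul_left a (fun z => w (z + b)), deriv_comp_add_const, smul_eq_mul]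
  have ex : ∀ (c : ℝ) (w : ℝ → ℝ → ℝ),
      dx (fun t x => c * w (d1 / d3 * t + d0) (d1 * x + d2))
        = fun t x => (c * d1) * dx w (d1 / d3 * t + d0) (d1 * x + d2) := fun c w => by
    funext t x
    simp only [dx, deriv_const_mul_field', key (w (d1 / d3 * t + d0))]; ring
  have et : ∀ (c : ℝ) (w : ℝ → ℝ → ℝ),
      dt (fun t x => c * w (d1 / d3 * t + d0) (d1 * x + d2))
        = fun t x => (c * (d1 / d3)) * dt w (d1 / d3 * t + d0) (d1 * x + d2) := fun c w => by
    funext t x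
    simp only [dt, deriv_const_mul_field', key (fun s => w s (d1 * x + d2))]; ring
  simp only [residual, hh, hl]
  rw [e, ex, ex, et, et]
  field_simp

end EquivTransf

/-- Equations equivalent with respect to the equivalence group of the class. -/
def Equivalent (I : Set ℝ) (h l : ℝ → ℝ) (I' : Set ℝ) (h' l' : ℝ → ℝ) : Prop :=
  ∃ g : EquivTransf, g.Maps I h l I' h' l'

/-! ### The classification list -/

/-- `h = ε |t|^ρ`, `l = lam |t|^((ρ-4)/2)` on an interval without `0`,
`ε = ±1`, `(ρ, lam) ≠ (0, 0)` -/
def IsCase1 (I : Set ℝ) (h l : ℝ → ℝ) (ε ρ lam : ℝ) : Prop :=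
  (ε = 1 ∨ ε = -1) ∧ (ρ, lam) ≠ (0, 0) ∧ (0 : ℝ) ∉ I ∧
    ∀ t ∈ I, h t = ε * |t| ^ ρ ∧ l t = lam * |t| ^ ((ρ - 4) / 2)

/-- `h = ε e^t`, `l = lam e^(t/2)`, `ε = ±1` -/
def IsCase2 (I : Set ℝ) (h l : ℝ → ℝ) (ε lam : ℝ) : Prop :=
  (ε = 1 ∨ ε = -1) ∧ ∀ t ∈ I, h t = ε * Real.exp t ∧ l t = lam * Real.exp (t / 2)

/-- `h = ε`, `l = 1`, `ε = ±1` -/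
def IsCase3 (I : Set ℝ) (h l : ℝ → ℝ) (ε : ℝ) : Prop :=
  (ε = 1 ∨ ε = -1) ∧ ∀ t ∈ I, h t = ε ∧ l t = 1

/-- `h = ε`, `l = 0`, `ε = ±1` -/
def IsCase4 (I : Set ℝ) (h l : ℝ → ℝ) (ε : ℝ) : Prop :=
  (ε = 1 ∨ ε = -1) ∧ ∀ t ∈ I, h t = ε ∧ l t = 0

/-- The equation belongs to the case with the given number, for some values of the constants;
`Fin 4` numbers Cases 1, 2, 3, 4 as `0, 1, 2, 3`. -/
def InCase (k : Fin 4) (I : Set ℝ) (h l : ℝ → ℝ) : Prop :=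
  match k with
  | 0 => ∃ ε ρ lam : ℝ, IsCase1 I h l ε ρ lam
  | 1 => ∃ ε lam : ℝ, IsCase2 I h l ε lam
  | 2 => ∃ ε : ℝ, IsCase3 I h l ε
  | 3 => ∃ ε : ℝ, IsCase4 I h l ε

end BBM

/-! The classification reduces to two linear ODEs for h and l. Since h ≠ 0, the equation can be
solved for u_xxt, so at a point all other derivatives of u are free parameters. Polynomial test
functions (`exists_jet`) realize the values needed, and the invariance criterion splits. The
coefficient of u_xtt gives τ_x = τ_u = 0, that of u_xxx gives ξ_t = ξ_u = 0, and those of u_xt and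
u_xx give η_uu = η_tu = 0 and 2η_xu = ξ_xx. The rest is affine in u_t and u_x, and its three
coefficients force τ = c₁t + c₀, ξ = ax + b, η = (a - c₁)u with (c₁t + c₀)h' = 2ah and (c₁t + c₀)l'
= (a - 2c₁)l (`invariance_solution`). The converse is a direct computation (`invariance_of_symEq`).
Thus `mem_Amax_iff` describes A^max by the triples (c₁, c₀, a) satisfying `SymEq`, together with a
free b that accounts for ∂_x.

For h = e^t, l = 1 the only triple is zero, which gives the kernel. As h ≠ 0, c₁ = c₀ = 0 forces a =
0, so an extension is a triple with (c₁, c₀) ≠ 0. Integrating the ODEs gives constants or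
exponentials if c₁ = 0, and powers of |t + c₀/c₁| if c₁ ≠ 0; when the zero of τ lies in I,
smoothness leaves only h constant, l = 0. The group parameters then normalize the constants
(`equivalentToCase_of_symEq`).

An equivalence transformation preserves c₁ and a and changes c₀ affinely (`EquivTransf.Maps.symEq`).
Three properties of the set of triples are therefore invariant, and they separate the four cases
(`case_unique`). -/

namespace BBM

/-! ### Directional derivatives of smooth functions on open sets -/

section DirectionalDerivative

variable {E : Type*} [NormedAddCommGroup E] [NormedSpace ℝ E]

/-- The derivative of `F` in the direction `v`. -/
noncomputable def dirDeriv (v : E) (F : E → ℝ) : E → ℝ := fun p => fderiv ℝ F p v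

theorem dirDeriv_contDiffOn {s : Set E} (hs : IsOpen s) {F : E → ℝ} (hF : ContDiffOn ℝ ∞ F s)
    (v : E) : ContDiffOn ℝ ∞ (dirDeriv v F) s :=
  (hF.fderiv_of_isOpen hs (m := ∞) (by simp)).clm_apply contDiffOn_const

theorem hasFDerivAt_of_contDiffOn {s : Set E} (hs : IsOpen s) {F : E → ℝ}
    (hF : ContDiffOn ℝ ∞ F s) {p : E} (hp : p ∈ s) : HasFDerivAt F (fderiv ℝ F p) p :=
  ((hF.contDiffAt (hs.mem_nhds hp)).differentiableAt (by simp)).hasFDerivAt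

theorem dirDeriv_congr {s : Set E} (hs : IsOpen s) {F G : E → ℝ} (h : Set.EqOn F G s) (v : E) :
    Set.EqOn (dirDeriv v F) (dirDeriv v G) s := fun _ hp => by
  rw [dirDeriv, dirDeriv, (h.eventuallyEq_of_mem (hs.mem_nhds hp)).fderiv_eq]

theorem dirDeriv_eq_zero {s : Set E} (hs : IsOpen s) {F : E → ℝ} (h : ∀ p ∈ s, F p = 0) (v : E) :
    ∀ p ∈ s, dirDeriv v F p = 0 := fun p hp => by
  rw [dirDeriv_congr hs (G := fun _ => 0) h v hp]; simp [dirDeriv]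

theorem dirDeriv_comm {s : Set E} (hs : IsOpen s) {F : E → ℝ} (hF : ContDiffOn ℝ ∞ F s)
    (v w : E) : Set.EqOn (dirDeriv v (dirDeriv w F)) (dirDeriv w (dirDeriv v F)) s := by
  intro p hp
  have hd : DifferentiableAt ℝ (fderiv ℝ F) p :=
    ((hF.fderiv_of_isOpen hs (m := ∞) (by simp)).contDiffAt (hs.mem_nhds hp)).differentiableAt
      (by simp)
  have key : ∀ a b : E, dirDeriv a (dirDeriv b F) p = fderiv ℝ (fderiv ℝ F) p a b := by
    intro a b
    have := (hd.hasFDerivAt.clm_apply (hasFDerivAt_const b p)).fderiv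
    unfold dirDeriv
    rw [this]; simp
  rw [key, key]
  exact ((hF.contDiffAt (hs.mem_nhds hp)).isSymmSndFDerivAt
    (by simpa using WithTop.coe_le_coe.2 (le_top : (2 : ℕ∞) ≤ ⊤))) v w

end DirectionalDerivative

/-! ### Calculus of functions of `(t, x)` that are smooth for `t ∈ I` -/

/-- Smoothness on `I × ℝ`. -/
def SmoothOn (I : Set ℝ) (f : ℝ → ℝ → ℝ) : Prop :=
  ContDiffOn ℝ ∞ (Function.uncurry f) (I ×ˢ Set.univ)

/-- Openness of `I` spreads the equality to a neighbourhood of t. In the x-direction (`dx_congr`)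
the equality holds on a whole line already. -/
theorem dt_congr {I : Set ℝ} (hI : IsOpen I) {f g : ℝ → ℝ → ℝ} (h : ∀ t ∈ I, ∀ x, f t x = g t x) :
    ∀ t ∈ I, ∀ x, dt f t x = dt g t x := fun t ht x => by
  refine Filter.EventuallyEq.deriv_eq ?_
  filter_upwards [hI.mem_nhds ht] with s hs using h s hs x

theorem dx_congr {I : Set ℝ} {f g : ℝ → ℝ → ℝ} (h : ∀ t ∈ I, ∀ x, f t x = g t x) :
    ∀ t ∈ I, ∀ x, dx f t x = dx g t x := fun t ht x => by
  simp only [dx, h t ht]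

namespace SmoothOn

variable {I : Set ℝ} {f g : ℝ → ℝ → ℝ}

theorem of_contDiff (h : ContDiff ℝ ∞ (Function.uncurry f)) : SmoothOn I f := h.contDiffOn

theorem add (hf : SmoothOn I f) (hg : SmoothOn I g) : SmoothOn I (fun t x => f t x + g t x) :=
  ContDiffOn.add hf hg

theorem sub (hf : SmoothOn I f) (hg : SmoothOn I g) : SmoothOn I (fun t x => f t x - g t x) :=
  ContDiffOn.sub hf hg

theorem mul (hf : SmoothOn I f) (hg : SmoothOn I g) : SmoothOn I (fun t x => f t x * g t x) :=
  ContDiffOn.mul hf hg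

theorem hasDerivAt_left (hI : IsOpen I) (hf : SmoothOn I f) {t : ℝ} (ht : t ∈ I) (x : ℝ) :
    HasDerivAt (fun s => f s x) (dirDeriv (1, 0) (Function.uncurry f) (t, x)) t := by
  have h := hasFDerivAt_of_contDiffOn (hI.prod isOpen_univ) hf (p := (t, x)) ⟨ht, trivial⟩
  exact h.comp_hasDerivAt t ((hasDerivAt_id t).prodMk (hasDerivAt_const t x))

theorem hasDerivAt_right (hI : IsOpen I) (hf : SmoothOn I f) {t : ℝ} (ht : t ∈ I) (x : ℝ) :
    HasDerivAt (fun y => f t y) (dirDeriv (0, 1) (Function.uncurry f) (t, x)) x := by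
  have h := hasFDerivAt_of_contDiffOn (hI.prod isOpen_univ) hf (p := (t, x)) ⟨ht, trivial⟩
  exact h.comp_hasDerivAt x ((hasDerivAt_const x t).prodMk (hasDerivAt_id x))

theorem dt_eq (hI : IsOpen I) (hf : SmoothOn I f) {t : ℝ} (ht : t ∈ I) (x : ℝ) :
    BBM.dt f t x = dirDeriv (1, 0) (Function.uncurry f) (t, x) :=
  (hf.hasDerivAt_left hI ht x).deriv

theorem dx_eq (hI : IsOpen I) (hf : SmoothOn I f) {t : ℝ} (ht : t ∈ I) (x : ℝ) :
    BBM.dx f t x = dirDeriv (0, 1) (Function.uncurry f) (t, x) :=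
  (hf.hasDerivAt_right hI ht x).deriv

theorem hasDt (hI : IsOpen I) (hf : SmoothOn I f) {t : ℝ} (ht : t ∈ I) (x : ℝ) :
    HasDerivAt (fun s => f s x) (BBM.dt f t x) t := by
  rw [hf.dt_eq hI ht]; exact hf.hasDerivAt_left hI ht x

theorem hasDx (hI : IsOpen I) (hf : SmoothOn I f) {t : ℝ} (ht : t ∈ I) (x : ℝ) :
    HasDerivAt (fun y => f t y) (BBM.dx f t x) x := by
  rw [hf.dx_eq hI ht]; exact hf.hasDerivAt_right hI ht x

theorem dt (hI : IsOpen I) (hf : SmoothOn I f) : SmoothOn I (BBM.dt f) :=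
  (dirDeriv_contDiffOn (hI.prod isOpen_univ) hf (1, 0)).congr fun p hp => hf.dt_eq hI hp.1 p.2

theorem dx (hI : IsOpen I) (hf : SmoothOn I f) : SmoothOn I (BBM.dx f) :=
  (dirDeriv_contDiffOn (hI.prod isOpen_univ) hf (0, 1)).congr fun p hp => hf.dx_eq hI hp.1 p.2

theorem dx_dt (hI : IsOpen I) (hf : SmoothOn I f) :
    ∀ t ∈ I, ∀ x, BBM.dx (BBM.dt f) t x = BBM.dt (BBM.dx f) t x := fun t ht x => by
  have hO := hI.prod (isOpen_univ (X := ℝ))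
  rw [(hf.dt hI).dx_eq hI ht, (hf.dx hI).dt_eq hI ht,
    dirDeriv_congr hO (F := Function.uncurry (BBM.dt f)) (G := dirDeriv (1, 0) (Function.uncurry f))
      (fun p hp => hf.dt_eq hI hp.1 p.2) _ ⟨ht, trivial⟩,
    dirDeriv_congr hO (F := Function.uncurry (BBM.dx f)) (G := dirDeriv (0, 1) (Function.uncurry f))
      (fun p hp => hf.dx_eq hI hp.1 p.2) _ ⟨ht, trivial⟩]
  exact dirDeriv_comm hO hf _ _ ⟨ht, trivial⟩

variable (hI : IsOpen I) (hf : SmoothOn I f) (hg : SmoothOn I g)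
include hI hf hg

theorem dt_add : ∀ t ∈ I, ∀ x, BBM.dt (fun t x => f t x + g t x) t x
    = BBM.dt f t x + BBM.dt g t x :=
  fun _ ht x => ((hf.hasDt hI ht x).add (hg.hasDt hI ht x)).deriv

theorem dx_add : ∀ t ∈ I, ∀ x, BBM.dx (fun t x => f t x + g t x) t x
    = BBM.dx f t x + BBM.dx g t x :=
  fun _ ht x => ((hf.hasDx hI ht x).add (hg.hasDx hI ht x)).deriv

theorem dt_sub : ∀ t ∈ I, ∀ x, BBM.dt (fun t x => f t x - g t x) t x
    = BBM.dt f t x - BBM.dt g t x :=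
  fun _ ht x => ((hf.hasDt hI ht x).sub (hg.hasDt hI ht x)).deriv

theorem dx_sub : ∀ t ∈ I, ∀ x, BBM.dx (fun t x => f t x - g t x) t x
    = BBM.dx f t x - BBM.dx g t x :=
  fun _ ht x => ((hf.hasDx hI ht x).sub (hg.hasDx hI ht x)).deriv

theorem dt_mul : ∀ t ∈ I, ∀ x, BBM.dt (fun t x => f t x * g t x) t x
    = BBM.dt f t x * g t x + f t x * BBM.dt g t x :=
  fun _ ht x => ((hf.hasDt hI ht x).mul (hg.hasDt hI ht x)).deriv

theorem dx_mul : ∀ t ∈ I, ∀ x, BBM.dx (fun t x => f t x * g t x) t x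
    = BBM.dx f t x * g t x + f t x * BBM.dx g t x :=
  fun _ ht x => ((hf.hasDx hI ht x).mul (hg.hasDx hI ht x)).deriv

/-- The mixed term stays a sum of two equal products, so that `dtxx_mul` can differentiate it with
the sum and product rules alone. -/
theorem dxx_mul : ∀ t ∈ I, ∀ x, BBM.dx (BBM.dx (fun t x => f t x * g t x)) t x
    = BBM.dx (BBM.dx f) t x * g t x + (BBM.dx f t x * BBM.dx g t x + BBM.dx f t x * BBM.dx g t x)
      + f t x * BBM.dx (BBM.dx g) t x := fun t ht x => by
  have hf' := hf.dx hI
  have hg' := hg.dx hI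
  rw [dx_congr (hf.dx_mul hI hg) t ht x, (hf'.mul hg).dx_add hI (hf.mul hg') t ht x,
    hf'.dx_mul hI hg t ht x, hf.dx_mul hI hg' t ht x]
  ring

theorem dtxx_mul : ∀ t ∈ I, ∀ x, BBM.dt (BBM.dx (BBM.dx (fun t x => f t x * g t x))) t x
    = BBM.dt (BBM.dx (BBM.dx f)) t x * g t x + BBM.dx (BBM.dx f) t x * BBM.dt g t x
      + 2 * (BBM.dt (BBM.dx f) t x * BBM.dx g t x) + 2 * (BBM.dx f t x * BBM.dt (BBM.dx g) t x)
      + BBM.dt f t x * BBM.dx (BBM.dx g) t x + f t x * BBM.dt (BBM.dx (BBM.dx g)) t x :=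
  fun t ht x => by
  have hf' := hf.dx hI
  have hg' := hg.dx hI
  have hf'' := hf'.dx hI
  have hg'' := hg'.dx hI
  have hm := hf'.mul hg'
  rw [dt_congr hI (hf.dxx_mul hI hg) t ht x,
    ((hf''.mul hg).add (hm.add hm)).dt_add hI (hf.mul hg'') t ht x,
    (hf''.mul hg).dt_add hI (hm.add hm) t ht x, hm.dt_add hI hm t ht x,
    hf''.dt_mul hI hg t ht x, hf'.dt_mul hI hg' t ht x, hf.dt_mul hI hg'' t ht x]
  ring

end SmoothOn

theorem dx_dt_of_contDiff {u : ℝ → ℝ → ℝ} (hu : ContDiff ℝ ∞ (Function.uncurry u)) :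
    dx (dt u) = dt (dx u) := by
  funext t x
  exact (SmoothOn.of_contDiff (I := Set.univ) hu).dx_dt isOpen_univ t trivial x

theorem contDiff_dx {u : ℝ → ℝ → ℝ} (hu : ContDiff ℝ ∞ (Function.uncurry u)) :
    ContDiff ℝ ∞ (Function.uncurry (dx u)) := by
  have := (SmoothOn.of_contDiff (I := Set.univ) hu).dx isOpen_univ
  rwa [SmoothOn, Set.univ_prod_univ, contDiffOn_univ] at this

/-! ### Total derivatives of functions of `(t, x, u)` -/

/-- The function `F(t, x, u)` evaluated along `u = u(t, x)`. -/
def along (F : ℝ × ℝ × ℝ → ℝ) (u : ℝ → ℝ → ℝ) : ℝ → ℝ → ℝ := fun t x => F (t, x, u t x)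

/-- Partial derivative with respect to `t` of a function of `(t, x, u)`. -/
noncomputable def pt (F : ℝ × ℝ × ℝ → ℝ) : ℝ × ℝ × ℝ → ℝ := dirDeriv (1, 0, 0) F

/-- Partial derivative with respect to `x` of a function of `(t, x, u)`. -/
noncomputable def px (F : ℝ × ℝ × ℝ → ℝ) : ℝ × ℝ × ℝ → ℝ := dirDeriv (0, 1, 0) F

/-- Partial derivative with respect to `u` of a function of `(t, x, u)`. -/
noncomputable def pu (F : ℝ × ℝ × ℝ → ℝ) : ℝ × ℝ × ℝ → ℝ := dirDeriv (0, 0, 1) F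

section TotalDerivatives

variable {I : Set ℝ} {F : ℝ × ℝ × ℝ → ℝ} {u : ℝ → ℝ → ℝ}

theorem isOpen_prod_univ (hI : IsOpen I) : IsOpen (I ×ˢ (Set.univ : Set (ℝ × ℝ))) :=
  hI.prod isOpen_univ

theorem pt_contDiffOn (hI : IsOpen I) (hF : ContDiffOn ℝ ∞ F (I ×ˢ Set.univ)) :
    ContDiffOn ℝ ∞ (pt F) (I ×ˢ Set.univ) := dirDeriv_contDiffOn (isOpen_prod_univ hI) hF _

theorem px_contDiffOn (hI : IsOpen I) (hF : ContDiffOn ℝ ∞ F (I ×ˢ Set.univ)) :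
    ContDiffOn ℝ ∞ (px F) (I ×ˢ Set.univ) := dirDeriv_contDiffOn (isOpen_prod_univ hI) hF _

theorem pu_contDiffOn (hI : IsOpen I) (hF : ContDiffOn ℝ ∞ F (I ×ˢ Set.univ)) :
    ContDiffOn ℝ ∞ (pu F) (I ×ˢ Set.univ) := dirDeriv_contDiffOn (isOpen_prod_univ hI) hF _

theorem fderiv_triple (F : ℝ × ℝ × ℝ → ℝ) (p : ℝ × ℝ × ℝ) (a b c : ℝ) :
    fderiv ℝ F p (a, b, c) = a * pt F p + b * px F p + c * pu F p := by
  have : ((a, b, c) : ℝ × ℝ × ℝ) = a • (1, 0, 0) + b • (0, 1, 0) + c • (0, 0, 1) := by simp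
  rw [this]
  simp only [map_add, map_smul, smul_eq_mul, pt, px, pu, dirDeriv]

theorem along_smoothOn (hF : ContDiffOn ℝ ∞ F (I ×ˢ Set.univ)) (hu : SmoothOn I u) :
    SmoothOn I (along F u) := by
  have hm : ContDiffOn ℝ ∞ (fun p : ℝ × ℝ => (p.1, p.2, Function.uncurry u p)) (I ×ˢ Set.univ) :=
    contDiffOn_fst.prodMk (contDiffOn_snd.prodMk hu)
  exact hF.comp hm fun p hp => ⟨hp.1, trivial⟩

theorem dt_along (hI : IsOpen I) (hF : ContDiffOn ℝ ∞ F (I ×ˢ Set.univ)) (hu : SmoothOn I u) :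
    ∀ t ∈ I, ∀ x, dt (along F u) t x = along (pt F) u t x + along (pu F) u t x * dt u t x := by
  intro t ht x
  have h := (hasFDerivAt_of_contDiffOn (isOpen_prod_univ hI) hF
    (p := (t, x, u t x)) ⟨ht, trivial⟩).comp_hasDerivAt t
      ((hasDerivAt_id t).prodMk ((hasDerivAt_const t x).prodMk (hu.hasDt hI ht x)))
  refine h.deriv.trans ?_
  rw [fderiv_triple, along, along]; ring

theorem dx_along (hI : IsOpen I) (hF : ContDiffOn ℝ ∞ F (I ×ˢ Set.univ)) (hu : SmoothOn I u) :
    ∀ t ∈ I, ∀ x, dx (along F u) t x = along (px F) u t x + along (pu F) u t x * dx u t x := by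
  intro t ht x
  have h := (hasFDerivAt_of_contDiffOn (isOpen_prod_univ hI) hF
    (p := (t, x, u t x)) ⟨ht, trivial⟩).comp_hasDerivAt x
      ((hasDerivAt_const x t).prodMk ((hasDerivAt_id x).prodMk (hu.hasDx hI ht x)))
  refine h.deriv.trans ?_
  rw [fderiv_triple, along, along]; ring

theorem dtx_along (hI : IsOpen I) (hF : ContDiffOn ℝ ∞ F (I ×ˢ Set.univ)) (hu : SmoothOn I u) :
    ∀ t ∈ I, ∀ x, dt (dx (along F u)) t x
      = along (pt (px F)) u t x + along (pu (px F)) u t x * dt u t x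
        + (along (pt (pu F)) u t x + along (pu (pu F)) u t x * dt u t x) * dx u t x
        + along (pu F) u t x * dt (dx u) t x := by
  intro t ht x
  have h1 := px_contDiffOn hI hF
  have h2 := pu_contDiffOn hI hF
  have s1 := along_smoothOn h1 hu
  have s2 := along_smoothOn h2 hu
  have hux := hu.dx hI
  rw [dt_congr hI (dx_along hI hF hu) t ht x, s1.dt_add hI (s2.mul hux) t ht x,
    s2.dt_mul hI hux t ht x, dt_along hI h1 hu t ht x, dt_along hI h2 hu t ht x]
  ring

theorem dxx_along (hI : IsOpen I) (hF : ContDiffOn ℝ ∞ F (I ×ˢ Set.univ)) (hu : SmoothOn I u) :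
    ∀ t ∈ I, ∀ x, dx (dx (along F u)) t x
      = along (px (px F)) u t x
        + (along (px (pu F)) u t x * dx u t x + along (px (pu F)) u t x * dx u t x)
        + along (pu (pu F)) u t x * (dx u t x * dx u t x)
        + along (pu F) u t x * dx (dx u) t x := by
  intro t ht x
  have h1 := px_contDiffOn hI hF
  have h2 := pu_contDiffOn hI hF
  have s1 := along_smoothOn h1 hu
  have s2 := along_smoothOn h2 hu
  have hux := hu.dx hI
  -- Symmetry of second derivatives merges the two contributions linear in u_x.
  have hc : along (pu (px F)) u t x = along (px (pu F)) u t x :=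
    dirDeriv_comm (isOpen_prod_univ hI) hF _ _ ⟨ht, trivial⟩
  rw [dx_congr (dx_along hI hF hu) t ht x, s1.dx_add hI (s2.mul hux) t ht x,
    s2.dx_mul hI hux t ht x, dx_along hI h1 hu t ht x, dx_along hI h2 hu t ht x, hc]
  ring

theorem dtxx_along (hI : IsOpen I) (hF : ContDiffOn ℝ ∞ F (I ×ˢ Set.univ)) (hu : SmoothOn I u) :
    ∀ t ∈ I, ∀ x, dt (dx (dx (along F u))) t x
      = along (pt (px (px F))) u t x + along (pu (px (px F))) u t x * dt u t x
        + 2 * (along (pt (px (pu F))) u t x + along (pu (px (pu F))) u t x * dt u t x) * dx u t x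
        + 2 * along (px (pu F)) u t x * dt (dx u) t x
        + (along (pt (pu (pu F))) u t x + along (pu (pu (pu F))) u t x * dt u t x) * dx u t x ^ 2
        + 2 * along (pu (pu F)) u t x * dx u t x * dt (dx u) t x
        + (along (pt (pu F)) u t x + along (pu (pu F)) u t x * dt u t x) * dx (dx u) t x
        + along (pu F) u t x * dt (dx (dx u)) t x := by
  intro t ht x
  have hu' := pu_contDiffOn hI hF
  have hxx := px_contDiffOn hI (px_contDiffOn hI hF)
  have hxu := px_contDiffOn hI hu'
  have huu := pu_contDiffOn hI hu'
  have su := along_smoothOn hu' hu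
  have sxx := along_smoothOn hxx hu
  have sxu := along_smoothOn hxu hu
  have suu := along_smoothOn huu hu
  have hux := hu.dx hI
  have huxx := hux.dx hI
  have m1 := sxu.mul hux
  have m2 := suu.mul (hux.mul hux)
  rw [dt_congr hI (dxx_along hI hF hu) t ht x,
    ((sxx.add (m1.add m1)).add m2).dt_add hI (su.mul huxx) t ht x,
    (sxx.add (m1.add m1)).dt_add hI m2 t ht x, sxx.dt_add hI (m1.add m1) t ht x,
    m1.dt_add hI m1 t ht x, sxu.dt_mul hI hux t ht x, suu.dt_mul hI (hux.mul hux) t ht x,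
    hux.dt_mul hI hux t ht x, su.dt_mul hI huxx t ht x,
    dt_along hI hu' hu t ht x, dt_along hI hxx hu t ht x, dt_along hI hxu hu t ht x,
    dt_along hI huu hu t ht x]
  ring

end TotalDerivatives

/-! ### The prolongation formula -/

/-- The action of the third prolongation, expressed without derivatives of the characteristic. -/
theorem prolongationAction_eq {I : Set ℝ} (hI : IsOpen I) (h l : ℝ → ℝ) {τ ξ η : ℝ × ℝ × ℝ → ℝ}
    (hτ : ContDiffOn ℝ ∞ τ (I ×ˢ Set.univ)) (hξ : ContDiffOn ℝ ∞ ξ (I ×ˢ Set.univ))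
    (hη : ContDiffOn ℝ ∞ η (I ×ˢ Set.univ)) {u : ℝ → ℝ → ℝ}
    (hu : ContDiff ℝ ∞ (Function.uncurry u)) {t : ℝ} (ht : t ∈ I) (x : ℝ) :
    prolongationAction h l τ ξ η u t x =
      along τ u t x * (deriv h t * dt (dx (dx u)) t x - deriv l t) + along η u t x * dx u t x
      + (dt (along η u) t x - dt (along τ u) t x * dt u t x - dt (along ξ u) t x * dx u t x)
      + u t x *
        (dx (along η u) t x - dx (along τ u) t x * dt u t x - dx (along ξ u) t x * dx u t x)
      + h t * (dt (dx (dx (along η u))) t x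
        - (dt (dx (dx (along τ u))) t x * dt u t x + dx (dx (along τ u)) t x * dt (dt u) t x
          + 2 * dt (dx (along τ u)) t x * dt (dx u) t x
          + 2 * dx (along τ u) t x * dt (dt (dx u)) t x
          + dt (along τ u) t x * dt (dx (dx u)) t x)
        - (dt (dx (dx (along ξ u))) t x * dx u t x + dx (dx (along ξ u)) t x * dt (dx u) t x
          + 2 * dt (dx (along ξ u)) t x * dx (dx u) t x
          + 2 * dx (along ξ u) t x * dt (dx (dx u)) t x
          + dt (along ξ u) t x * dx (dx (dx u)) t x)) := by
  have su : SmoothOn I u := SmoothOn.of_contDiff hu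
  have A := along_smoothOn hη su
  have B := along_smoothOn hτ su
  have C := along_smoothOn hξ su
  have ut := su.dt hI
  have ux := su.dx hI
  have cx := contDiff_dx hu
  have c1 := dx_dt_of_contDiff hu
  have c2 := dx_dt_of_contDiff cx
  have c3 := dx_dt_of_contDiff (contDiff_dx cx)
  have AB := A.sub (B.mul ut)
  have hQ : characteristic τ ξ η u
      = fun t x => (along η u t x - along τ u t x * dt u t x) - along ξ u t x * dx u t x := rfl
  have hT : dt (characteristic τ ξ η u) t x = dt (along η u) t x
      - (dt (along τ u) t x * dt u t x + along τ u t x * dt (dt u) t x)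
      - (dt (along ξ u) t x * dx u t x + along ξ u t x * dt (dx u) t x) := by
    rw [hQ, AB.dt_sub hI (C.mul ux) t ht x, A.dt_sub hI (B.mul ut) t ht x,
      B.dt_mul hI ut t ht x, C.dt_mul hI ux t ht x]
  have hX : ∀ t ∈ I, ∀ x, dx (characteristic τ ξ η u) t x
      = (dx (along η u) t x - dx (fun t x => along τ u t x * dt u t x) t x)
        - dx (fun t x => along ξ u t x * dx u t x) t x := by
    intro t ht x
    rw [hQ, AB.dx_sub hI (C.mul ux) t ht x, A.dx_sub hI (B.mul ut) t ht x]
  have A' := A.dx hI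
  have B' := (B.mul ut).dx hI
  have C' := (C.mul ux).dx hI
  have hXX : ∀ t ∈ I, ∀ x, dx (dx (characteristic τ ξ η u)) t x
      = (dx (dx (along η u)) t x - dx (dx (fun t x => along τ u t x * dt u t x)) t x)
        - dx (dx (fun t x => along ξ u t x * dx u t x)) t x := by
    intro t ht x
    rw [dx_congr hX t ht x, (A'.sub B').dx_sub hI C' t ht x, A'.dx_sub hI B' t ht x]
  have hXXT : dt (dx (dx (characteristic τ ξ η u))) t x
      = (dt (dx (dx (along η u))) t x - dt (dx (dx (fun t x => along τ u t x * dt u t x))) t x)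
        - dt (dx (dx (fun t x => along ξ u t x * dx u t x))) t x := by
    rw [dt_congr hI hXX t ht x, ((A'.dx hI).sub (B'.dx hI)).dt_sub hI (C'.dx hI) t ht x,
      (A'.dx hI).dt_sub hI (B'.dx hI) t ht x]
  rw [prolongationAction, prolT, prolX, prolXXT, hT, hXXT, hX t ht x, B.dtxx_mul hI ut t ht x,
    C.dtxx_mul hI ux t ht x, B.dx_mul hI ut t ht x, C.dx_mul hI ux t ht x]
  -- With the mixed derivatives in a common order, the undifferentiated τ and ξ terms coming from
  -- the characteristic cancel those added in `prolT`, `prolX` and `prolXXT`; no fourth-order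
  -- derivative of u survives.
  simp only [c1, c2, c3, along]
  ring

/-! ### Test functions with prescribed jets -/

theorem deriv_cubic (c₀ c₁ c₂ c₃ a x : ℝ) :
    deriv (fun y => c₀ + c₁ * (y - a) + c₂ * (y - a) ^ 2 + c₃ * (y - a) ^ 3) x
      = c₁ + 2 * c₂ * (x - a) + 3 * c₃ * (x - a) ^ 2 := by
  have h : HasDerivAt (fun y : ℝ => y - a) 1 x := (hasDerivAt_id x).sub_const a
  have := (((h.const_mul c₁).const_add c₀).add ((h.pow 2).const_mul c₂)).add
    ((h.pow 3).const_mul c₃)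
  refine this.deriv.trans ?_
  norm_num
  ring

theorem dt_cubic {u : ℝ → ℝ → ℝ} (f₀ f₁ f₂ f₃ : ℝ → ℝ) (a : ℝ)
    (h : ∀ t x, u t x = f₀ x + f₁ x * (t - a) + f₂ x * (t - a) ^ 2 + f₃ x * (t - a) ^ 3) :
    dt u = fun t x => f₁ x + 2 * f₂ x * (t - a) + 3 * f₃ x * (t - a) ^ 2 := by
  funext t x; simp only [dt, h]; exact deriv_cubic _ _ _ _ _ _

theorem dx_cubic {u : ℝ → ℝ → ℝ} (f₀ f₁ f₂ f₃ : ℝ → ℝ) (a : ℝ)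
    (h : ∀ t x, u t x = f₀ t + f₁ t * (x - a) + f₂ t * (x - a) ^ 2 + f₃ t * (x - a) ^ 3) :
    dx u = fun t x => f₁ t + 2 * f₂ t * (x - a) + 3 * f₃ t * (x - a) ^ 2 := by
  funext t x; simp only [dx, h]; exact deriv_cubic _ _ _ _ _ _

/-- Polynomials realize all values of the derivatives that occur in the determining equations. -/
theorem exists_jet (t₀ x₀ v p q b c d e w : ℝ) :
    ∃ u : ℝ → ℝ → ℝ, ContDiff ℝ ∞ (Function.uncurry u) ∧ u t₀ x₀ = v ∧ dt u t₀ x₀ = p ∧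
      dx u t₀ x₀ = q ∧ dt (dt u) t₀ x₀ = 0 ∧ dt (dx u) t₀ x₀ = b ∧ dx (dx u) t₀ x₀ = c ∧
      dt (dt (dx u)) t₀ x₀ = d ∧ dx (dx (dx u)) t₀ x₀ = e ∧ dt (dx (dx u)) t₀ x₀ = w := by
  -- A Taylor polynomial, with denominators cancelling the factorials. No (t - t₀)² term is needed:
  -- the u_tt coefficient D_x²τ vanishes anyway once u_xtt has given τ_x = τ_u = 0.
  let u : ℝ → ℝ → ℝ := fun t x => v + p * (t - t₀) + q * (x - x₀) + b * (t - t₀) * (x - x₀)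
    + c / 2 * (x - x₀) ^ 2 + d / 2 * (t - t₀) ^ 2 * (x - x₀) + e / 6 * (x - x₀) ^ 3
    + w / 2 * (t - t₀) * (x - x₀) ^ 2
  have hx := dx_cubic (u := u) (fun t => v + p * (t - t₀))
    (fun t => q + b * (t - t₀) + d / 2 * (t - t₀) ^ 2) (fun t => c / 2 + w / 2 * (t - t₀))
    (fun _ => e / 6) x₀ fun t x => by simp only [u]; ring
  have hxx := dx_cubic (u := dx u) (fun t => q + b * (t - t₀) + d / 2 * (t - t₀) ^ 2)
    (fun t => c + w * (t - t₀)) (fun _ => e / 2) (fun _ => 0) x₀ fun t x => by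
      rw [hx]; ring
  have hxxx := dx_cubic (u := dx (dx u)) (fun t => c + w * (t - t₀)) (fun _ => e) (fun _ => 0)
    (fun _ => 0) x₀ fun t x => by rw [hxx]; ring
  have ht := dt_cubic (u := u) (fun x => v + q * (x - x₀) + c / 2 * (x - x₀) ^ 2
    + e / 6 * (x - x₀) ^ 3) (fun x => p + b * (x - x₀) + w / 2 * (x - x₀) ^ 2)
    (fun x => d / 2 * (x - x₀)) (fun _ => 0) t₀ fun t x => by simp only [u]; ring
  have htt := dt_cubic (u := dt u) (fun x => p + b * (x - x₀) + w / 2 * (x - x₀) ^ 2)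
    (fun x => d * (x - x₀)) (fun _ => 0) (fun _ => 0) t₀ fun t x => by rw [ht]; ring
  have hxt := dt_cubic (u := dx u) (fun x => q + c * (x - x₀) + e / 2 * (x - x₀) ^ 2)
    (fun x => b + w * (x - x₀)) (fun _ => d / 2) (fun _ => 0) t₀ fun t x => by rw [hx]; ring
  have hxtt := dt_cubic (u := dt (dx u)) (fun x => b + w * (x - x₀)) (fun _ => d) (fun _ => 0)
    (fun _ => 0) t₀ fun t x => by rw [hxt]; ring
  have hxxt := dt_cubic (u := dx (dx u)) (fun x => c + e * (x - x₀)) (fun _ => w) (fun _ => 0)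
    (fun _ => 0) t₀ fun t x => by rw [hxx]; ring
  refine ⟨u, ?_, ?_, ?_, ?_, ?_, ?_, ?_, ?_, ?_, ?_⟩
  · simp only [u]; fun_prop
  · simp [u]
  · simp [ht]
  · simp [hx]
  · simp [htt]
  · simp [hxt]
  · simp [hxx]
  · simp [hxtt]
  · simp [hxxx]
  · simp [hxxt]

/-! ### The determining equations -/

/-- The coefficients `c₁ t + c₀`, `a x + b`, `(a - c₁) u` satisfy the determining equations. -/
def SymEq (I : Set ℝ) (h l : ℝ → ℝ) (c₁ c₀ a : ℝ) : Prop :=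
  ∀ t ∈ I, (c₁ * t + c₀) * deriv h t = 2 * a * h t ∧ (c₁ * t + c₀) * deriv l t = (a - 2 * c₁) * l t

/-! ### Tools for solving the determining equations on I × ℝ² -/

section

variable {I : Set ℝ} {F : ℝ × ℝ × ℝ → ℝ}

/-- `F` and the linear function αt + βx + γu have the same derivative on the connected open set I ×
ℝ², hence differ by a constant. -/
theorem eq_affine_of_partials (hI : IsOpenInterval I) (hF : ContDiffOn ℝ ∞ F (I ×ˢ Set.univ))
    {α β γ : ℝ} (ht : ∀ p ∈ I ×ˢ Set.univ, pt F p = α) (hx : ∀ p ∈ I ×ˢ Set.univ, px F p = β)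
    (hu : ∀ p ∈ I ×ˢ Set.univ, pu F p = γ) :
    ∃ k : ℝ, ∀ t ∈ I, ∀ x v : ℝ, F (t, x, v) = α * t + β * x + γ * v + k := by
  have hO := isOpen_prod_univ hI.isOpen
  have hc : IsPreconnected (I ×ˢ (Set.univ : Set (ℝ × ℝ))) :=
    hI.ordConnected.isPreconnected.prod isPreconnected_univ
  let G : ℝ × ℝ × ℝ → ℝ := fun p => α * p.1 + β * p.2.1 + γ * p.2.2
  have hG : Differentiable ℝ G := by fun_prop
  obtain ⟨k, hk⟩ := hO.exists_eq_add_of_fderiv_eq (𝕜 := ℝ) (f := F) (g := G) hc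
    (fun p hp => (hasFDerivAt_of_contDiffOn hO hF hp).differentiableAt.differentiableWithinAt)
    hG.differentiableOn (fun p hp => by
      have e : HasFDerivAt G (α • ContinuousLinearMap.fst ℝ ℝ (ℝ × ℝ)
          + β • (ContinuousLinearMap.fst ℝ ℝ ℝ).comp (ContinuousLinearMap.snd ℝ ℝ (ℝ × ℝ))
          + γ • (ContinuousLinearMap.snd ℝ ℝ ℝ).comp (ContinuousLinearMap.snd ℝ ℝ (ℝ × ℝ))) p :=
        ((hasFDerivAt_fst.const_mul α).add
          ((hasFDerivAt_fst.comp p hasFDerivAt_snd).const_mul β)).add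
          ((hasFDerivAt_snd.comp p hasFDerivAt_snd).const_mul γ)
      rw [e.fderiv]
      refine ContinuousLinearMap.ext fun ⟨a, b, c⟩ => ?_
      rw [fderiv_triple, ht p hp, hx p hp, hu p hp]
      simp
      ring)
  exact ⟨k, fun t ht x v => hk (x := (t, x, v)) ⟨ht, trivial⟩⟩

theorem hasDerivAt_pu (hI : IsOpen I) (hF : ContDiffOn ℝ ∞ F (I ×ˢ Set.univ)) {t : ℝ} (ht : t ∈ I)
    (x v : ℝ) : HasDerivAt (fun s => F (t, x, s)) (pu F (t, x, v)) v :=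
  (hasFDerivAt_of_contDiffOn (isOpen_prod_univ hI) hF (p := (t, x, v))
    ⟨ht, trivial⟩).comp_hasDerivAt v
    ((hasDerivAt_const v t).prodMk ((hasDerivAt_const v x).prodMk (hasDerivAt_id v)))

theorem hasDerivAt_px (hI : IsOpen I) (hF : ContDiffOn ℝ ∞ F (I ×ˢ Set.univ)) {t : ℝ} (ht : t ∈ I)
    (x v : ℝ) : HasDerivAt (fun s => F (t, s, v)) (px F (t, x, v)) x :=
  (hasFDerivAt_of_contDiffOn (isOpen_prod_univ hI) hF (p := (t, x, v))
    ⟨ht, trivial⟩).comp_hasDerivAt x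
    ((hasDerivAt_const x t).prodMk ((hasDerivAt_id x).prodMk (hasDerivAt_const x v)))

theorem hasDerivAt_pt (hI : IsOpen I) (hF : ContDiffOn ℝ ∞ F (I ×ˢ Set.univ)) {t : ℝ} (ht : t ∈ I)
    (x v : ℝ) : HasDerivAt (fun s => F (s, x, v)) (pt F (t, x, v)) t :=
  (hasFDerivAt_of_contDiffOn (isOpen_prod_univ hI) hF (p := (t, x, v))
    ⟨ht, trivial⟩).comp_hasDerivAt t
    ((hasDerivAt_id t).prodMk ((hasDerivAt_const t x).prodMk (hasDerivAt_const t v)))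

theorem eq_of_pu_eq_zero (hI : IsOpen I) (hF : ContDiffOn ℝ ∞ F (I ×ˢ Set.univ))
    (h : ∀ p ∈ I ×ˢ Set.univ, pu F p = 0) {t : ℝ} (ht : t ∈ I) (x v w : ℝ) :
    F (t, x, v) = F (t, x, w) :=
  is_const_of_deriv_eq_zero (f := fun s => F (t, x, s))
    (fun s => (hasDerivAt_pu hI hF ht x s).differentiableAt)
    (fun s => (hasDerivAt_pu hI hF ht x s).deriv.trans (h _ ⟨ht, trivial⟩)) v w

theorem pt_eq_zero_of_slice (hI : IsOpen I) (hF : ContDiffOn ℝ ∞ F (I ×ˢ Set.univ)) {x v : ℝ}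
    (h : ∀ t ∈ I, F (t, x, v) = 0) {t : ℝ} (ht : t ∈ I) : pt F (t, x, v) = 0 := by
  rw [← (hasDerivAt_pt hI hF ht x v).deriv]
  have : (fun s => F (s, x, v)) =ᶠ[nhds t] fun _ => 0 := by
    filter_upwards [hI.mem_nhds ht] with s hs using h s hs
  rw [this.deriv_eq, deriv_const]

theorem px_eq_zero_of_slice (hI : IsOpen I) (hF : ContDiffOn ℝ ∞ F (I ×ˢ Set.univ)) {t v : ℝ}
    (ht : t ∈ I) (h : ∀ x, F (t, x, v) = 0) (x : ℝ) : px F (t, x, v) = 0 := by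
  rw [← (hasDerivAt_px hI hF ht x v).deriv]
  simp [h]

theorem pt_px (hI : IsOpen I) (hF : ContDiffOn ℝ ∞ F (I ×ˢ Set.univ)) {p : ℝ × ℝ × ℝ}
    (hp : p ∈ I ×ˢ Set.univ) : pt (px F) p = px (pt F) p :=
  dirDeriv_comm (isOpen_prod_univ hI) hF _ _ hp

theorem pu_px (hI : IsOpen I) (hF : ContDiffOn ℝ ∞ F (I ×ˢ Set.univ)) {p : ℝ × ℝ × ℝ}
    (hp : p ∈ I ×ˢ Set.univ) : pu (px F) p = px (pu F) p :=
  dirDeriv_comm (isOpen_prod_univ hI) hF _ _ hp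

theorem pu_pt (hI : IsOpen I) (hF : ContDiffOn ℝ ∞ F (I ×ˢ Set.univ)) {p : ℝ × ℝ × ℝ}
    (hp : p ∈ I ×ˢ Set.univ) : pu (pt F) p = pt (pu F) p :=
  dirDeriv_comm (isOpen_prod_univ hI) hF _ _ hp

variable (hI : IsOpen I) (h0 : ∀ p ∈ I ×ˢ Set.univ, F p = 0)
include hI h0

theorem pt_eq_zero : ∀ p ∈ I ×ˢ Set.univ, pt F p = 0 :=
  dirDeriv_eq_zero (isOpen_prod_univ hI) h0 _

theorem px_eq_zero : ∀ p ∈ I ×ˢ Set.univ, px F p = 0 :=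
  dirDeriv_eq_zero (isOpen_prod_univ hI) h0 _

theorem pu_eq_zero : ∀ p ∈ I ×ˢ Set.univ, pu F p = 0 :=
  dirDeriv_eq_zero (isOpen_prod_univ hI) h0 _

end

/-! ### Splitting the invariance criterion -/

section Determining

variable {I : Set ℝ} {h l : ℝ → ℝ} {τ ξ η : ℝ × ℝ × ℝ → ℝ}

/-- The invariance criterion at a point, with the derivatives of `u` as independent variables. -/
theorem invariance_jet (hI : IsOpen I) (hτ : ContDiffOn ℝ ∞ τ (I ×ˢ Set.univ))
    (hξ : ContDiffOn ℝ ∞ ξ (I ×ˢ Set.univ)) (hη : ContDiffOn ℝ ∞ η (I ×ˢ Set.univ))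
    (hinv : InvarianceCriterion I h l τ ξ η) {t : ℝ} (ht : t ∈ I) (x v p q b c d e w : ℝ)
    (hres : p + v * q + h t * w - l t = 0) :
    τ (t, x, v) * (deriv h t * w - deriv l t) + η (t, x, v) * q
    + (pt η (t, x, v) + pu η (t, x, v) * p - (pt τ (t, x, v) + pu τ (t, x, v) * p) * p
      - (pt ξ (t, x, v) + pu ξ (t, x, v) * p) * q)
    + v * (px η (t, x, v) + pu η (t, x, v) * q - (px τ (t, x, v) + pu τ (t, x, v) * q) * p
      - (px ξ (t, x, v) + pu ξ (t, x, v) * q) * q)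
    + h t * ((pt (px (px η)) (t, x, v) + pu (px (px η)) (t, x, v) * p
        + 2 * (pt (px (pu η)) (t, x, v) + pu (px (pu η)) (t, x, v) * p) * q
        + 2 * px (pu η) (t, x, v) * b
        + (pt (pu (pu η)) (t, x, v) + pu (pu (pu η)) (t, x, v) * p) * q ^ 2
        + 2 * pu (pu η) (t, x, v) * q * b + (pt (pu η) (t, x, v) + pu (pu η) (t, x, v) * p) * c
        + pu η (t, x, v) * w)
      - ((pt (px (px τ)) (t, x, v) + pu (px (px τ)) (t, x, v) * p
        + 2 * (pt (px (pu τ)) (t, x, v) + pu (px (pu τ)) (t, x, v) * p) * q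
        + 2 * px (pu τ) (t, x, v) * b
        + (pt (pu (pu τ)) (t, x, v) + pu (pu (pu τ)) (t, x, v) * p) * q ^ 2
        + 2 * pu (pu τ) (t, x, v) * q * b + (pt (pu τ) (t, x, v) + pu (pu τ) (t, x, v) * p) * c
        + pu τ (t, x, v) * w) * p
        + 2 * (pt (px τ) (t, x, v) + pu (px τ) (t, x, v) * p
          + (pt (pu τ) (t, x, v) + pu (pu τ) (t, x, v) * p) * q + pu τ (t, x, v) * b) * b
        + 2 * (px τ (t, x, v) + pu τ (t, x, v) * q) * d
        + (pt τ (t, x, v) + pu τ (t, x, v) * p) * w)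
      - ((pt (px (px ξ)) (t, x, v) + pu (px (px ξ)) (t, x, v) * p
        + 2 * (pt (px (pu ξ)) (t, x, v) + pu (px (pu ξ)) (t, x, v) * p) * q
        + 2 * px (pu ξ) (t, x, v) * b
        + (pt (pu (pu ξ)) (t, x, v) + pu (pu (pu ξ)) (t, x, v) * p) * q ^ 2
        + 2 * pu (pu ξ) (t, x, v) * q * b + (pt (pu ξ) (t, x, v) + pu (pu ξ) (t, x, v) * p) * c
        + pu ξ (t, x, v) * w) * q
        + (px (px ξ) (t, x, v) + 2 * px (pu ξ) (t, x, v) * q + pu (pu ξ) (t, x, v) * q ^ 2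
          + pu ξ (t, x, v) * c) * b
        + 2 * (pt (px ξ) (t, x, v) + pu (px ξ) (t, x, v) * p
          + (pt (pu ξ) (t, x, v) + pu (pu ξ) (t, x, v) * p) * q + pu ξ (t, x, v) * b) * c
        + 2 * (px ξ (t, x, v) + pu ξ (t, x, v) * q) * w
        + (pt ξ (t, x, v) + pu ξ (t, x, v) * p) * e)) = 0 := by
  obtain ⟨u, hu, h1, h2, h3, h4, h5, h6, h7, h8, h9⟩ := exists_jet t x v p q b c d e w
  have su : SmoothOn I u := SmoothOn.of_contDiff hu
  have key := hinv u hu t ht x (by rw [residual, h1, h2, h3, h9]; exact hres)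
  rw [prolongationAction_eq hI h l hτ hξ hη hu ht x, dt_along hI hτ su t ht x,
    dt_along hI hξ su t ht x, dt_along hI hη su t ht x, dx_along hI hτ su t ht x,
    dx_along hI hξ su t ht x, dx_along hI hη su t ht x, dtx_along hI hτ su t ht x,
    dtx_along hI hξ su t ht x, dxx_along hI hξ su t ht x, dtxx_along hI hτ su t ht x,
    dtxx_along hI hξ su t ht x, dtxx_along hI hη su t ht x, h1, h2, h3, h4, h5, h6, h7, h8,
    h9] at key
  simp only [along, h1] at key
  linear_combination key

/-- The coefficients of `∂_t` and `∂_x` depend only on `t` and on `x`, respectively. -/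
theorem invariance_first_step (hI : IsOpen I) (hh : ∀ t ∈ I, h t ≠ 0)
    (hτ : ContDiffOn ℝ ∞ τ (I ×ˢ Set.univ))
    (hξ : ContDiffOn ℝ ∞ ξ (I ×ˢ Set.univ)) (hη : ContDiffOn ℝ ∞ η (I ×ˢ Set.univ))
    (hinv : InvarianceCriterion I h l τ ξ η) {p : ℝ × ℝ × ℝ} (hp : p ∈ I ×ˢ Set.univ) :
    px τ p = 0 ∧ pu τ p = 0 ∧ pt ξ p = 0 ∧ pu ξ p = 0 := by
  obtain ⟨t, x, v⟩ := p
  have ht : t ∈ I := hp.1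
  have h0 := hh t ht
  -- The equation is solved for u_xxt, which leaves the other derivatives free.
  have hres : ∀ p q : ℝ, p + v * q + h t * ((l t - p - v * q) / h t) - l t = 0 := by
    intro p q; field_simp; ring
  -- Jets with u_xtt = 0 and u_xtt = 1 isolate the coefficient -2h D_xτ; q = u_x is still free.
  have hd : ∀ q, px τ (t, x, v) + pu τ (t, x, v) * q = 0 := fun q => by
    have e0 := invariance_jet hI hτ hξ hη hinv ht x v 0 q 0 0 0 0 _ (hres 0 q)
    have e1 := invariance_jet hI hτ hξ hη hinv ht x v 0 q 0 0 1 0 _ (hres 0 q)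
    have : h t * (2 * (px τ (t, x, v) + pu τ (t, x, v) * q)) = 0 := by
      linear_combination e0 - e1
    simpa [h0] using this
  -- Likewise u_xxx isolates -h D_tξ, with p = u_t free.
  have he : ∀ p, pt ξ (t, x, v) + pu ξ (t, x, v) * p = 0 := fun p => by
    have e0 := invariance_jet hI hτ hξ hη hinv ht x v p 0 0 0 0 0 _ (hres p 0)
    have e1 := invariance_jet hI hτ hξ hη hinv ht x v p 0 0 0 0 1 _ (hres p 0)
    have : h t * (pt ξ (t, x, v) + pu ξ (t, x, v) * p) = 0 := by
      linear_combination e0 - e1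
    simpa [h0] using this
  have d0 := hd 0
  have d1 := hd 1
  have e0 := he 0
  have e1 := he 1
  refine ⟨?_, ?_, ?_, ?_⟩ <;> linarith

end Determining

section Determining

variable {I : Set ℝ} {h l : ℝ → ℝ} {τ ξ η : ℝ × ℝ × ℝ → ℝ}

/-- The invariance criterion after the first step. -/
theorem invariance_second_step (hI : IsOpen I) (hh : ∀ t ∈ I, h t ≠ 0)
    (hτ : ContDiffOn ℝ ∞ τ (I ×ˢ Set.univ)) (hξ : ContDiffOn ℝ ∞ ξ (I ×ˢ Set.univ))
    (hη : ContDiffOn ℝ ∞ η (I ×ˢ Set.univ)) (hinv : InvarianceCriterion I h l τ ξ η)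
    {t : ℝ} (ht : t ∈ I) (x v p q b c w : ℝ) (hres : p + v * q + h t * w - l t = 0) :
    τ (t, x, v) * (deriv h t * w - deriv l t) + η (t, x, v) * q
    + (pt η (t, x, v) + pu η (t, x, v) * p - pt τ (t, x, v) * p)
    + v * (px η (t, x, v) + pu η (t, x, v) * q - px ξ (t, x, v) * q)
    + h t * (pt (px (px η)) (t, x, v) + pu (px (px η)) (t, x, v) * p
        + 2 * (pt (px (pu η)) (t, x, v) + pu (px (pu η)) (t, x, v) * p) * q
        + 2 * px (pu η) (t, x, v) * b
        + (pt (pu (pu η)) (t, x, v) + pu (pu (pu η)) (t, x, v) * p) * q ^ 2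
        + 2 * pu (pu η) (t, x, v) * q * b + (pt (pu η) (t, x, v) + pu (pu η) (t, x, v) * p) * c
        + pu η (t, x, v) * w - pt τ (t, x, v) * w - px (px ξ) (t, x, v) * b
        - 2 * px ξ (t, x, v) * w) = 0 := by
  have hp : (t, x, v) ∈ I ×ˢ (Set.univ : Set (ℝ × ℝ)) := ⟨ht, trivial⟩
  have hfirst := fun p hp => invariance_first_step (p := p) hI hh hτ hξ hη hinv hp
  have x0 := fun p hp => (hfirst p hp).1
  have u0 := fun p hp => (hfirst p hp).2.1
  have t1 := fun p hp => (hfirst p hp).2.2.1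
  have u1 := fun p hp => (hfirst p hp).2.2.2
  have x0x := px_eq_zero hI x0
  have u0x := px_eq_zero hI u0
  have u0u := pu_eq_zero hI u0
  have u1x := px_eq_zero hI u1
  have u1u := pu_eq_zero hI u1
  have x1t : ∀ p ∈ I ×ˢ Set.univ, pt (px ξ) p = 0 := fun p hp =>
    (pt_px hI hξ hp).trans (px_eq_zero hI t1 p hp)
  have x1u : ∀ p ∈ I ×ˢ Set.univ, pu (px ξ) p = 0 := fun p hp =>
    (pu_px hI hξ hp).trans (u1x p hp)
  have x1xt : pt (px (px ξ)) (t, x, v) = 0 :=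
    (pt_px hI (px_contDiffOn hI hξ) hp).trans (px_eq_zero hI x1t _ hp)
  have x1xu : pu (px (px ξ)) (t, x, v) = 0 :=
    (pu_px hI (px_contDiffOn hI hξ) hp).trans (px_eq_zero hI x1u _ hp)
  have key := invariance_jet hI hτ hξ hη hinv ht x v p q b c 0 0 w hres
  simp only [x0 _ hp, u0 _ hp, t1 _ hp, u1 _ hp, pt_eq_zero hI x0 _ hp, pt_eq_zero hI x0x _ hp,
    pu_eq_zero hI x0x _ hp, pu_eq_zero hI x0 _ hp, u0x _ hp, u0u _ hp, pt_eq_zero hI u0 _ hp,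
    pt_eq_zero hI u0x _ hp, pu_eq_zero hI u0x _ hp, pt_eq_zero hI u0u _ hp,
    pu_eq_zero hI u0u _ hp, x1t _ hp, x1u _ hp, x1xt, x1xu, u1x _ hp, u1u _ hp,
    pt_eq_zero hI u1 _ hp, pt_eq_zero hI u1x _ hp, pu_eq_zero hI u1x _ hp, pt_eq_zero hI u1u _ hp,
    pu_eq_zero hI u1u _ hp] at key
  linear_combination key

/-- The consequences of the second step for `η`. -/
theorem invariance_eta (hI : IsOpen I) (hh : ∀ t ∈ I, h t ≠ 0)
    (hτ : ContDiffOn ℝ ∞ τ (I ×ˢ Set.univ)) (hξ : ContDiffOn ℝ ∞ ξ (I ×ˢ Set.univ))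
    (hη : ContDiffOn ℝ ∞ η (I ×ˢ Set.univ)) (hinv : InvarianceCriterion I h l τ ξ η)
    {p : ℝ × ℝ × ℝ} (hp : p ∈ I ×ˢ Set.univ) :
    pu (pu η) p = 0 ∧ 2 * px (pu η) p = px (px ξ) p ∧ pt (pu η) p = 0 := by
  obtain ⟨t, x, v⟩ := p
  have ht : t ∈ I := hp.1
  have h0 := hh t ht
  have hres : ∀ p q : ℝ, p + v * q + h t * ((l t - p - v * q) / h t) - l t = 0 := by
    intro p q; field_simp; ring
  -- The coefficient of u_xt, affine in u_x: q = 0 and q = 1 separate its two parts.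
  have hb : ∀ q, 2 * px (pu η) (t, x, v) + 2 * pu (pu η) (t, x, v) * q
      - px (px ξ) (t, x, v) = 0 := fun q => by
    have e0 := invariance_second_step hI hh hτ hξ hη hinv ht x v 0 q 0 0 _ (hres 0 q)
    have e1 := invariance_second_step hI hh hτ hξ hη hinv ht x v 0 q 1 0 _ (hres 0 q)
    have : h t * (2 * px (pu η) (t, x, v) + 2 * pu (pu η) (t, x, v) * q
      - px (px ξ) (t, x, v)) = 0 := by
      linear_combination e1 - e0
    simpa only [mul_eq_zero, h0, false_or] using this
  -- The coefficient of u_xx, taken at u_t = 0.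
  have hc : pt (pu η) (t, x, v) = 0 := by
    have e0 := invariance_second_step hI hh hτ hξ hη hinv ht x v 0 0 0 0 _ (hres 0 0)
    have e1 := invariance_second_step hI hh hτ hξ hη hinv ht x v 0 0 0 1 _ (hres 0 0)
    have : h t * pt (pu η) (t, x, v) = 0 := by linear_combination e1 - e0
    simpa only [mul_eq_zero, h0, false_or] using this
  have b0 := hb 0
  have b1 := hb 1
  refine ⟨?_, ?_, hc⟩ <;> linarith

/-- The equations obtained by splitting with respect to the first derivatives of `u`. -/
theorem invariance_split (hI : IsOpen I) (hh : ∀ t ∈ I, h t ≠ 0)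
    (hτ : ContDiffOn ℝ ∞ τ (I ×ˢ Set.univ)) (hξ : ContDiffOn ℝ ∞ ξ (I ×ˢ Set.univ))
    (hη : ContDiffOn ℝ ∞ η (I ×ˢ Set.univ)) (hinv : InvarianceCriterion I h l τ ξ η)
    {t : ℝ} (ht : t ∈ I) (x v : ℝ) :
    (τ (t, x, v) * (deriv h t * (l t / h t) - deriv l t) + pt η (t, x, v) + v * px η (t, x, v)
      + h t * pt (px (px η)) (t, x, v)
      + (pu η (t, x, v) - pt τ (t, x, v) - 2 * px ξ (t, x, v)) * l t = 0) ∧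
    τ (t, x, v) * deriv h t = h t * (2 * px ξ (t, x, v) + h t * pu (px (px η)) (t, x, v)) ∧
    h t * η (t, x, v) = v * (τ (t, x, v) * deriv h t
      - h t * (px ξ (t, x, v) + pt τ (t, x, v))) := by
  have h0 := hh t ht
  have hp : (t, x, v) ∈ I ×ˢ (Set.univ : Set (ℝ × ℝ)) := ⟨ht, trivial⟩
  have hηp := fun p hp => invariance_eta (p := p) hI hh hτ hξ hη hinv hp
  have uu := fun p hp => (hηp p hp).1
  have tu := fun p hp => (hηp p hp).2.2
  have hu := pu_contDiffOn hI hη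
  have txu : pt (px (pu η)) (t, x, v) = 0 := (pt_px hI hu hp).trans (px_eq_zero hI tu _ hp)
  have uxu : pu (px (pu η)) (t, x, v) = 0 := (pu_px hI hu hp).trans (px_eq_zero hI uu _ hp)
  -- With u_xxt eliminated, the relations for η make the criterion affine in (p, q), so the values
  -- at (0,0), (1,0) and (0,1) determine its coefficients.
  have key : ∀ p q : ℝ, _ := fun p q =>
    invariance_second_step hI hh hτ hξ hη hinv ht x v p q 0 0 ((l t - p - v * q) / h t)
      (by field_simp; ring)
  simp only [txu, uxu, uu _ hp, tu _ hp, pt_eq_zero hI uu _ hp, pu_eq_zero hI uu _ hp] at key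
  have k0 := key 0 0
  have k1 := key 1 0
  have k2 := key 0 1
  refine ⟨?_, ?_, ?_⟩
  · field_simp at k0 ⊢
    linear_combination k0
  · field_simp at k0 k1
    linear_combination k0 - k1
  · field_simp at k0 k2
    linear_combination k2 - k0

/-- Solution of the determining equations. -/
theorem invariance_solution (hI : IsOpenInterval I) (hh : ∀ t ∈ I, h t ≠ 0)
    (hτ : ContDiffOn ℝ ∞ τ (I ×ˢ Set.univ)) (hξ : ContDiffOn ℝ ∞ ξ (I ×ˢ Set.univ))
    (hη : ContDiffOn ℝ ∞ η (I ×ˢ Set.univ)) (hinv : InvarianceCriterion I h l τ ξ η) :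
    ∃ c₁ c₀ a b : ℝ, SymEq I h l c₁ c₀ a ∧ ∀ t ∈ I, ∀ x v : ℝ,
      τ (t, x, v) = c₁ * t + c₀ ∧ ξ (t, x, v) = a * x + b ∧ η (t, x, v) = (a - c₁) * v := by
  have hO := hI.isOpen
  have hfirst := fun p hp => invariance_first_step (p := p) hO hh hτ hξ hη hinv hp
  have x0 := fun p hp => (hfirst p hp).1
  have u0 := fun p hp => (hfirst p hp).2.1
  have t1 := fun p hp => (hfirst p hp).2.2.1
  have u1 := fun p hp => (hfirst p hp).2.2.2
  have hηp := fun p hp => invariance_eta (p := p) hO hh hτ hξ hη hinv hp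
  have uu := fun p hp => (hηp p hp).1
  have xu := fun p hp => (hηp p hp).2.1
  have tu := fun p hp => (hηp p hp).2.2
  have split := fun (t : ℝ) (ht : t ∈ I) x v => invariance_split hO hh hτ hξ hη hinv ht x v
  -- The u_x-coefficient writes hη as u times a factor, so η vanishes at u = 0.
  have η0 : ∀ t ∈ I, ∀ x, η (t, x, 0) = 0 := fun t ht x => by
    simpa [hh t ht] using (split t ht x 0).2.2
  have hηt := pt_contDiffOn hO hη
  have hηx := px_contDiffOn hO hη
  have hηu := pu_contDiffOn hO hη
  have hξx := px_contDiffOn hO hξ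
  have hτt := pt_contDiffOn hO hτ
  -- By η_tu = 0, η_t does not depend on u, and it vanishes at u = 0.
  have ηt : ∀ p ∈ I ×ˢ Set.univ, pt η p = 0 := by
    rintro ⟨t, x, v⟩ hp
    rw [eq_of_pu_eq_zero hO hηt (fun p hp => (pu_pt hO hη hp).trans (tu p hp)) hp.1 x v 0]
    exact pt_eq_zero_of_slice hO hη (fun s hs => η0 s hs x) hp.1
  have ηtxx : ∀ p ∈ I ×ˢ Set.univ, pt (px (px η)) p = 0 := by
    have : ∀ p ∈ I ×ˢ Set.univ, pt (px η) p = 0 := fun p hp =>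
      (pt_px hO hη hp).trans (px_eq_zero hO ηt p hp)
    exact fun p hp => (pt_px hO hηx hp).trans (px_eq_zero hO this p hp)
  have ξxu : ∀ p ∈ I ×ˢ Set.univ, pu (px ξ) p = 0 := fun p hp =>
    (pu_px hO hξ hp).trans (px_eq_zero hO u1 p hp)
  have ξxt : ∀ p ∈ I ×ˢ Set.univ, pt (px ξ) p = 0 := fun p hp =>
    (pt_px hO hξ hp).trans (px_eq_zero hO t1 p hp)
  have τtu : ∀ p ∈ I ×ˢ Set.univ, pu (pt τ) p = 0 := fun p hp =>
    (pu_pt hO hτ hp).trans (pt_eq_zero hO u0 p hp)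
  -- In the first split equation every term except uη_x is independent of u; subtracting its value
  -- at u = 0 leaves uη_x = 0.
  have ηx : ∀ p ∈ I ×ˢ Set.univ, px η p = 0 := by
    rintro ⟨t, x, v⟩ hp
    have ht : t ∈ I := hp.1
    rcases eq_or_ne v 0 with rfl | hv
    · exact px_eq_zero_of_slice hO hη ht (fun x => η0 t ht x) x
    · have k := (split t ht x v).1
      have k0 := (split t ht x 0).1
      rw [ηt _ hp, ηtxx _ hp, eq_of_pu_eq_zero hO hτ u0 ht x v 0,
        eq_of_pu_eq_zero hO hηu uu ht x v 0, eq_of_pu_eq_zero hO hτt τtu ht x v 0,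
        eq_of_pu_eq_zero hO hξx ξxu ht x v 0] at k
      rw [ηt _ ⟨ht, trivial⟩, ηtxx _ ⟨ht, trivial⟩] at k0
      have : v * px η (t, x, v) = 0 := by linear_combination k - k0
      simpa [hv] using this
  have ηxu : ∀ p ∈ I ×ˢ Set.univ, px (pu η) p = 0 := fun p hp =>
    (pu_px hO hη hp).symm.trans (pu_eq_zero hO ηx p hp)
  have ηxxu := pu_eq_zero hO (px_eq_zero hO ηx)
  have ξxx : ∀ p ∈ I ×ˢ Set.univ, px (px ξ) p = 0 := fun p hp => by
    rw [← xu p hp, ηxu p hp, mul_zero]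
  obtain ⟨a, ha⟩ := eq_affine_of_partials hI hξx ξxt ξxx ξxu
  obtain ⟨φ, hφ⟩ := eq_affine_of_partials hI hηu tu ηxu uu
  simp only [zero_mul, zero_add] at ha hφ
  obtain ⟨b, hb⟩ := eq_affine_of_partials hI hξ t1 (fun p hp => ha p.1 hp.1 p.2.1 p.2.2) u1
  obtain ⟨k, hk⟩ := eq_affine_of_partials hI hη ηt ηx (fun p hp => hφ p.1 hp.1 p.2.1 p.2.2)
  simp only [zero_mul, zero_add, add_zero] at hb hk
  obtain ⟨t₁, ht₁⟩ := hI.nonempty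
  have hk0 : k = 0 := by
    have e := hk t₁ ht₁ 0 0
    rw [η0 t₁ ht₁ 0] at e
    linarith
  subst hk0
  have hτh : ∀ t ∈ I, ∀ x v, τ (t, x, v) * deriv h t = 2 * a * h t := fun t ht x v => by
    have e := (split t ht x v).2.1
    rw [ha t ht, ηxxu _ ⟨ht, trivial⟩] at e
    linear_combination e
  -- The third split equation at u = 1 reads hφ = 2ah - h(a + τ_t).
  have hτt' : ∀ p ∈ I ×ˢ Set.univ, pt τ p = a - φ := by
    rintro ⟨t, x, v⟩ hp
    have ht : t ∈ I := hp.1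
    have e := (split t ht x 1).2.2
    rw [ha t ht, hτh t ht, hk t ht, ← eq_of_pu_eq_zero hO hτt τtu ht x v 1] at e
    apply mul_left_cancel₀ (hh t ht)
    linear_combination e
  obtain ⟨c, hc⟩ := eq_affine_of_partials hI hτ hτt' x0 u0
  simp only [zero_mul, add_zero] at hc
  refine ⟨a - φ, c, a, b, fun t ht => ?_, fun t ht x v => ⟨hc t ht x v, hb t ht x v, ?_⟩⟩
  · rw [← hc t ht 0 0]
    refine ⟨hτh t ht 0 0, ?_⟩
    -- At u = 0 the first split equation becomes the condition on l, once τh' is replaced by 2ah.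
    have e := (split t ht 0 0).1
    have hp : (t, (0 : ℝ), (0 : ℝ)) ∈ I ×ˢ (Set.univ : Set (ℝ × ℝ)) := ⟨ht, trivial⟩
    rw [ηt _ hp, ηtxx _ hp, hτt' _ hp, ha t ht, hφ t ht] at e
    have e2 : τ (t, 0, 0) * (deriv h t * (l t / h t)) = 2 * a * l t := by
      have h0 := hh t ht
      rw [← mul_assoc, hτh t ht]; field_simp
    linear_combination e2 - e
  · rw [hk t ht]; ring

/-- Solutions of the determining equations give Lie symmetries. -/
theorem invariance_of_symEq (hI : IsOpen I) {c₁ c₀ a : ℝ} (hs : SymEq I h l c₁ c₀ a) (b : ℝ) :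
    InvarianceCriterion I h l (fun p => c₁ * p.1 + c₀) (fun p => a * p.2.1 + b)
      (fun p => (a - c₁) * p.2.2) := by
  intro u hu t ht x hres
  have hl : ∀ (c d y : ℝ), deriv (fun y => c * y + d) y = c := fun c d y => by
    simp
  have A1 : along (fun p => (a - c₁) * p.2.2) u = fun t x => (a - c₁) * u t x := rfl
  have A2 : dx (fun t x => (a - c₁) * u t x) = fun t x => (a - c₁) * dx u t x := by
    funext t x; simp [dx, deriv_const_mul_field']
  have A3 : dx (fun t x => (a - c₁) * dx u t x) = fun t x => (a - c₁) * dx (dx u) t x := by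
    funext t x; simp [dx, deriv_const_mul_field']
  have A4 : ∀ f : ℝ → ℝ → ℝ, dt (fun t x => (a - c₁) * f t x) = fun t x => (a - c₁) * dt f t x := by
    intro f; funext t x; simp [dt, deriv_const_mul_field']
  have B1 : along (fun p => c₁ * p.1 + c₀) u = fun t _ => c₁ * t + c₀ := rfl
  have B2 : dx (fun t (_ : ℝ) => c₁ * t + c₀) = fun _ _ => 0 := by funext t x; simp [dx]
  have B3 : dt (fun t (_ : ℝ) => c₁ * t + c₀) = fun _ _ => c₁ := by
    funext t x; exact hl _ _ _
  have C1 : along (fun p => a * p.2.1 + b) u = fun _ x => a * x + b := rfl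
  have C2 : dx (fun (_ : ℝ) x => a * x + b) = fun _ _ => a := by
    funext t x; exact hl _ _ _
  have C3 : dt (fun (_ : ℝ) x => a * x + b) = fun _ _ => 0 := by funext t x; simp [dt]
  have Z1 : ∀ k : ℝ, dx (fun _ _ => k) = fun _ _ => 0 := by intro k; funext t x; simp [dx]
  have Z2 : ∀ k : ℝ, dt (fun _ _ => k) = fun _ _ => 0 := by intro k; funext t x; simp [dt]
  rw [prolongationAction_eq hI h l (by fun_prop) (by fun_prop) (by fun_prop) hu ht x]
  simp only [A1, A2, A3, A4, B1, B2, B3, C1, C2, C3, Z1, Z2]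
  obtain ⟨e1, e2⟩ := hs t ht
  rw [residual] at hres
  -- The prolonged field multiplies the left side of the equation by a - 2c₁, up to the two
  -- conditions in `SymEq`.
  linear_combination (dt (dx (dx u)) t x) * e1 - e2 + (a - 2 * c₁) * hres

end Determining

/-- The vector field `(c₁ t + c₀) ∂_t + (a x + b) ∂_x + (a - c₁) u ∂_u`. -/
def affineField (I : Set ℝ) (c₁ c₀ a b : ℝ) : VectorField I :=
  fun p => (c₁ * (p.1 : ℝ) + c₀, a * p.2.1 + b, (a - c₁) * p.2.2)

theorem mem_Amax_iff {I : Set ℝ} {h l : ℝ → ℝ} (hI : IsOpenInterval I) (hh : ∀ t ∈ I, h t ≠ 0)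
    (Γ : VectorField I) :
    Γ ∈ Amax I h l ↔ ∃ c₁ c₀ a b : ℝ, SymEq I h l c₁ c₀ a ∧ Γ = affineField I c₁ c₀ a b := by
  constructor
  · rintro ⟨τ, ξ, η, hτ, hξ, hη, hinv, hΓ⟩
    obtain ⟨c₁, c₀, a, b, hs, hv⟩ := invariance_solution hI hh hτ hξ hη hinv
    refine ⟨c₁, c₀, a, b, hs, funext fun p => ?_⟩
    obtain ⟨e1, e2, e3⟩ := hv p.1 p.1.2 p.2.1 p.2.2
    rw [hΓ, affineField, e1, e2, e3]
  · rintro ⟨c₁, c₀, a, b, hs, rfl⟩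
    exact ⟨_, _, _, by fun_prop, by fun_prop, by fun_prop, invariance_of_symEq hI.isOpen hs b,
      fun p => rfl⟩

/-! ### Symmetry algebras in the cases of the classification list -/

theorem deriv_eq_of_eqOn {I : Set ℝ} (hI : IsOpen I) {f g : ℝ → ℝ} (h : ∀ t ∈ I, f t = g t)
    {t d : ℝ} (ht : t ∈ I) (hg : HasDerivAt g d t) : deriv f t = d := by
  have : f =ᶠ[nhds t] g := by filter_upwards [hI.mem_nhds ht] with s hs using h s hs
  rw [this.deriv_eq, hg.deriv]

/-- Dividing by t rather than |t| absorbs the sign from the derivative of |t|, so one formula serves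
both half-lines. -/
theorem hasDerivAt_abs_rpow {t : ℝ} (ht : t ≠ 0) (r : ℝ) :
    HasDerivAt (fun s => |s| ^ r) (r * |t| ^ r / t) t := by
  have h := (hasDerivAt_abs ht).rpow_const (p := r) (Or.inl (abs_ne_zero.2 ht))
  convert h using 1
  rw [Real.rpow_sub_one (abs_ne_zero.2 ht)]
  rcases lt_or_gt_of_ne ht with h | h
  · rw [abs_of_neg h]; simp [h]; field_simp
  · rw [abs_of_pos h]; simp [h]; field_simp

/-! ### Functions on open intervals -/

namespace IsOpenInterval

variable {I : Set ℝ} (hI : IsOpenInterval I)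
include hI

theorem exists_ne : ∃ s ∈ I, ∃ t ∈ I, s ≠ t := by
  obtain ⟨t, ht⟩ := hI.nonempty
  obtain ⟨ε, hε, hb⟩ := Metric.isOpen_iff.1 hI.isOpen t ht
  refine ⟨t + ε / 2, hb ?_, t, ht, by linarith⟩
  rw [Metric.mem_ball, Real.dist_eq]
  rw [abs_of_pos] <;> linarith

theorem affine_eq_zero {α β : ℝ} (h : ∀ t ∈ I, α * t + β = 0) : α = 0 ∧ β = 0 := by
  obtain ⟨s, hs, t, ht, hne⟩ := hI.exists_ne
  have h1 := h s hs
  have h2 := h t ht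
  have : α * (s - t) = 0 := by linear_combination h1 - h2
  have hα : α = 0 := by simpa [sub_ne_zero.2 hne] using this
  subst hα
  simpa using h1

theorem eq_of_deriv_eq_zero {f : ℝ → ℝ} (h : ∀ t ∈ I, HasDerivAt f 0 t) {s t : ℝ} (hs : s ∈ I)
    (ht : t ∈ I) : f s = f t :=
  hI.isOpen.is_const_of_deriv_eq_zero hI.ordConnected.isPreconnected
    (fun r hr => (h r hr).differentiableAt.differentiableWithinAt) (fun r hr => (h r hr).deriv)
    hs ht

end IsOpenInterval

theorem eps_ne_zero {ε : ℝ} (h : ε = 1 ∨ ε = -1) : ε ≠ 0 := by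
  rcases h with rfl | rfl <;> norm_num

section Cases

variable {I : Set ℝ} {h l : ℝ → ℝ} {ε ρ lam : ℝ} (hI : IsOpenInterval I)
include hI

/-- The condition on h becomes (c₁ρ - 2a)t + c₀ρ = 0. For ρ = 0 it leaves c₀ free, and the condition
on l with λ ≠ 0 removes it; this is where (ρ, λ) ≠ (0, 0) enters. -/
theorem symEq_case1 (H : IsCase1 I h l ε ρ lam) (c₁ c₀ a : ℝ) :
    SymEq I h l c₁ c₀ a ↔ c₀ = 0 ∧ 2 * a = c₁ * ρ := by
  obtain ⟨hε, hρ, h0, hv⟩ := H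
  have hne : ∀ t ∈ I, t ≠ 0 := fun t ht e => h0 (e ▸ ht)
  have hpos : ∀ t ∈ I, ∀ r : ℝ, |t| ^ r ≠ 0 := fun t ht r =>
    (Real.rpow_pos_of_pos (abs_pos.2 (hne t ht)) r).ne'
  have dh : ∀ t ∈ I, deriv h t = ε * (ρ * |t| ^ ρ / t) := fun t ht =>
    deriv_eq_of_eqOn hI.isOpen (fun s hs => (hv s hs).1) ht
      ((hasDerivAt_abs_rpow (hne t ht) ρ).const_mul ε)
  have dl : ∀ t ∈ I, deriv l t = lam * ((ρ - 4) / 2 * |t| ^ ((ρ - 4) / 2) / t) := fun t ht =>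
    deriv_eq_of_eqOn hI.isOpen (fun s hs => (hv s hs).2) ht
      ((hasDerivAt_abs_rpow (hne t ht) ((ρ - 4) / 2)).const_mul lam)
  constructor
  · intro hs
    have e1 : ∀ t ∈ I, (c₁ * ρ - 2 * a) * t + c₀ * ρ = 0 := fun t ht => by
      have e := (hs t ht).1
      rw [dh t ht, (hv t ht).1] at e
      have h1 := hne t ht
      have h2 := hpos t ht ρ
      have h3 := eps_ne_zero hε
      field_simp at e
      linear_combination e
    obtain ⟨e2, e3⟩ := hI.affine_eq_zero e1
    rcases eq_or_ne ρ 0 with hρ0 | hρ0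
    · subst hρ0
      have hlam : lam ≠ 0 := fun e => hρ (by rw [e])
      obtain ⟨t, ht⟩ := hI.nonempty
      have e := (hs t ht).2
      rw [dl t ht, (hv t ht).2] at e
      have h1 := hne t ht
      have h2 := hpos t ht ((0 - 4) / 2)
      have ha : a = 0 := by linarith
      subst ha
      generalize |t| ^ (((0 : ℝ) - 4) / 2) = y at *
      field_simp at e
      constructor <;> linarith
    · exact ⟨by simpa [hρ0] using e3, by linarith⟩
  · rintro ⟨rfl, ha⟩ t ht
    have h1 := hne t ht
    rw [dh t ht, dl t ht, (hv t ht).1, (hv t ht).2]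
    obtain rfl : a = c₁ * ρ / 2 := by linarith
    generalize |t| ^ ρ = y
    generalize |t| ^ ((ρ - 4) / 2) = z
    constructor <;> field_simp <;> ring

theorem symEq_case2 (H : IsCase2 I h l ε lam) (c₁ c₀ a : ℝ) :
    SymEq I h l c₁ c₀ a ↔ c₁ = 0 ∧ c₀ = 2 * a := by
  obtain ⟨hε, hv⟩ := H
  have dh : ∀ t ∈ I, deriv h t = ε * Real.exp t := fun t ht =>
    deriv_eq_of_eqOn hI.isOpen (fun s hs => (hv s hs).1) ht ((Real.hasDerivAt_exp t).const_mul ε)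
  have dl : ∀ t ∈ I, deriv l t = lam * (Real.exp (t / 2) * (1 / 2)) := fun t ht =>
    deriv_eq_of_eqOn hI.isOpen (fun s hs => (hv s hs).2) ht
      ((((hasDerivAt_id t).div_const 2).exp).const_mul lam)
  constructor
  · intro hs
    have e1 : ∀ t ∈ I, c₁ * t + (c₀ - 2 * a) = 0 := fun t ht => by
      have e := (hs t ht).1
      rw [dh t ht, (hv t ht).1] at e
      have h2 := Real.exp_ne_zero t
      have h3 := eps_ne_zero hε
      apply mul_left_cancel₀ (mul_ne_zero h3 h2)
      linear_combination e
    obtain ⟨e2, e3⟩ := hI.affine_eq_zero e1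
    exact ⟨e2, by linarith⟩
  · rintro ⟨rfl, rfl⟩ t ht
    rw [dh t ht, dl t ht, (hv t ht).1, (hv t ht).2]
    constructor <;> ring

theorem symEq_of_const {α β : ℝ} (hα : α ≠ 0) (hv : ∀ t ∈ I, h t = α ∧ l t = β) (c₁ c₀ a : ℝ) :
    SymEq I h l c₁ c₀ a ↔ a = 0 ∧ c₁ * β = 0 := by
  have dh : ∀ t ∈ I, deriv h t = 0 := fun t ht =>
    deriv_eq_of_eqOn hI.isOpen (fun s hs => (hv s hs).1) ht (hasDerivAt_const t _)
  have dl : ∀ t ∈ I, deriv l t = 0 := fun t ht =>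
    deriv_eq_of_eqOn hI.isOpen (fun s hs => (hv s hs).2) ht (hasDerivAt_const t _)
  constructor
  · intro hs
    obtain ⟨t, ht⟩ := hI.nonempty
    obtain ⟨e1, e2⟩ := hs t ht
    rw [dh t ht, (hv t ht).1] at e1
    rw [dl t ht, (hv t ht).2] at e2
    have ha : a = 0 := by simpa [hα] using e1
    subst ha
    exact ⟨rfl, by linarith⟩
  · rintro ⟨rfl, hc⟩ t ht
    rw [dh t ht, dl t ht, (hv t ht).1, (hv t ht).2]
    constructor
    · ring
    · linear_combination 2 * hc

theorem symEq_case3 (H : IsCase3 I h l ε) (c₁ c₀ a : ℝ) :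
    SymEq I h l c₁ c₀ a ↔ a = 0 ∧ c₁ = 0 := by
  rw [symEq_of_const hI (eps_ne_zero H.1) H.2, mul_one]

theorem symEq_case4 (H : IsCase4 I h l ε) (c₁ c₀ a : ℝ) : SymEq I h l c₁ c₀ a ↔ a = 0 := by
  rw [symEq_of_const hI (eps_ne_zero H.1) H.2, mul_zero]
  simp

end Cases

/-! ### Bases of the maximal Lie invariance algebras -/

theorem linearIndependent_fieldX {I : Set ℝ} (hI : IsOpenInterval I) :
    LinearIndependent ℝ ![fieldX I] := by
  obtain ⟨t, ht⟩ := hI.nonempty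
  rw [linearIndependent_unique_iff]
  intro e
  have := congrFun e (⟨t, ht⟩, 0, 0)
  simp [fieldX] at this

theorem isBasisOf_pair {I : Set ℝ} {X Y : VectorField I} {A : Set (VectorField I)}
    (hli : ∀ r s : ℝ, r • X + s • Y = 0 → r = 0 ∧ s = 0)
    (hA : ∀ Γ, Γ ∈ A ↔ ∃ r s : ℝ, r • X + s • Y = Γ) : IsBasisOf ![X, Y] A := by
  refine ⟨LinearIndependent.pair_iff.2 hli, ?_⟩
  ext Γ
  rw [hA, SetLike.mem_coe, Matrix.range_cons, Matrix.range_cons, Matrix.range_empty,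
    Set.union_empty, Set.singleton_union, Submodule.mem_span_pair]

theorem smul_fieldX_add_apply {I : Set ℝ} (r s : ℝ) (Y : VectorField I) (p : I × ℝ × ℝ) :
    (r • fieldX I + s • Y) p = (s * (Y p).1, r + s * (Y p).2.1, s * (Y p).2.2) := by
  simp [fieldX, Prod.ext_iff]

section Bases

variable {I : Set ℝ} {h l : ℝ → ℝ} {ε ρ lam : ℝ} (H : InClass I h l)
include H

/-- Covers Cases 1-3, where the triples form the line through (k₁, k₀, k) and ∂_x supplies the free
b. Independence holds because `Y` has a nonzero ∂_t-component. -/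
theorem isBasisOf_Amax_pair {Y : VectorField I} {k₁ k₀ k : ℝ} (hk : (k₁, k₀) ≠ (0, 0))
    (hY : Y = affineField I k₁ k₀ k 0)
    (hs : ∀ c₁ c₀ a, SymEq I h l c₁ c₀ a ↔ ∃ s, c₁ = s * k₁ ∧ c₀ = s * k₀ ∧ a = s * k) :
    IsBasisOf ![fieldX I, Y] (Amax I h l) := by
  subst hY
  refine isBasisOf_pair (fun r s e => ?_) fun Γ => ?_
  · have e1 : ∀ t ∈ I, s * k₁ * t + s * k₀ = 0 := fun t ht => by
      have := congrArg Prod.fst (congrFun e (⟨t, ht⟩, 0, 0))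
      rw [smul_fieldX_add_apply] at this
      simp only [affineField, Pi.zero_apply, Prod.fst_zero] at this
      linear_combination this
    obtain ⟨e2, e3⟩ := H.interval.affine_eq_zero e1
    have hs0 : s = 0 := by
      by_contra hs0
      exact hk (Prod.ext (by simpa [hs0] using e2) (by simpa [hs0] using e3))
    obtain ⟨t, ht⟩ := H.interval.nonempty
    have := congrArg (fun z => z.2.1) (congrFun e (⟨t, ht⟩, 0, 0))
    rw [smul_fieldX_add_apply] at this
    simp only [affineField, Pi.zero_apply, hs0] at this
    exact ⟨by simpa using this, hs0⟩
  · rw [mem_Amax_iff H.interval H.h_ne_zero]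
    constructor
    · rintro ⟨c₁, c₀, a, b, hc, rfl⟩
      obtain ⟨s, rfl, rfl, rfl⟩ := (hs _ _ _).1 hc
      refine ⟨b, s, funext fun p => ?_⟩
      rw [smul_fieldX_add_apply]
      simp only [affineField, Prod.mk.injEq]
      refine ⟨?_, ?_, ?_⟩ <;> ring
    · rintro ⟨r, s, rfl⟩
      refine ⟨s * k₁, s * k₀, s * k, r, (hs _ _ _).2 ⟨s, rfl, rfl, rfl⟩, funext fun p => ?_⟩
      rw [smul_fieldX_add_apply]
      simp only [affineField, Prod.mk.injEq]
      refine ⟨?_, ?_, ?_⟩ <;> ring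

theorem isBasisOf_case1 (hc : IsCase1 I h l ε ρ lam) :
    IsBasisOf ![fieldX I, fieldPower I ρ] (Amax I h l) := by
  refine isBasisOf_Amax_pair H (k₁ := 2) (k₀ := 0) (k := ρ) (by simp) ?_ fun c₁ c₀ a => ?_
  · funext p; simp [fieldPower, affineField]
  · rw [symEq_case1 H.interval hc]
    constructor
    · rintro ⟨rfl, h2⟩
      exact ⟨c₁ / 2, by ring, by ring, by linarith⟩
    · rintro ⟨s, rfl, rfl, rfl⟩
      exact ⟨by ring, by ring⟩

theorem isBasisOf_case2 (hc : IsCase2 I h l ε lam) :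
    IsBasisOf ![fieldX I, fieldExp I] (Amax I h l) := by
  refine isBasisOf_Amax_pair H (k₁ := 0) (k₀ := 2) (k := 1) (by simp) ?_ fun c₁ c₀ a => ?_
  · funext p; simp [fieldExp, affineField]
  · rw [symEq_case2 H.interval hc]
    constructor
    · rintro ⟨rfl, rfl⟩
      exact ⟨a, by ring, by ring, by ring⟩
    · rintro ⟨s, rfl, rfl, rfl⟩
      exact ⟨by ring, by ring⟩

theorem isBasisOf_case3 (hc : IsCase3 I h l ε) :
    IsBasisOf ![fieldX I, fieldT I] (Amax I h l) := by
  refine isBasisOf_Amax_pair H (k₁ := 0) (k₀ := 1) (k := 0) (by simp) ?_ fun c₁ c₀ a => ?_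
  · funext p; simp [fieldT, affineField]
  · rw [symEq_case3 H.interval hc]
    constructor
    · rintro ⟨rfl, rfl⟩
      exact ⟨c₀, by ring, by ring, by ring⟩
    · rintro ⟨s, rfl, rfl, rfl⟩
      exact ⟨by ring, by ring⟩

theorem isBasisOf_case4 (hc : IsCase4 I h l ε) :
    IsBasisOf ![fieldX I, fieldT I, fieldScale I] (Amax I h l) := by
  have hcomb : ∀ (g : Fin 3 → ℝ), ∑ i, g i • ![fieldX I, fieldT I, fieldScale I] i
      = affineField I (g 2) (g 1) 0 (g 0) := fun g => by
    funext p
    simp [Fin.sum_univ_three, fieldX, fieldT, fieldScale, affineField, Prod.ext_iff]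
    ring
  constructor
  · rw [Fintype.linearIndependent_iff]
    intro g hg
    rw [hcomb] at hg
    obtain ⟨t, ht⟩ := H.interval.nonempty
    -- At x = 0, u = 1 the components are g₂t + g₁, g₀ and -g₂, enough to recover all three
    -- coefficients.
    have e := congrFun hg (⟨t, ht⟩, 0, 1)
    simp only [affineField, Pi.zero_apply, Prod.ext_iff, Prod.fst_zero, Prod.snd_zero] at e
    obtain ⟨e1, e2, e3⟩ := e
    have g2 : g 2 = 0 := by linarith
    rw [g2] at e1
    intro i
    fin_cases i
    · simpa using e2
    · simpa using e1
    · exact g2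
  · ext Γ
    rw [SetLike.mem_coe, Submodule.mem_span_range_iff_exists_fun,
      mem_Amax_iff H.interval H.h_ne_zero]
    simp only [hcomb, symEq_case4 H.interval hc]
    constructor
    · rintro ⟨c₁, c₀, a, b, rfl, rfl⟩
      exact ⟨![b, c₀, c₁], rfl⟩
    · rintro ⟨g, rfl⟩
      exact ⟨_, _, _, _, rfl, rfl⟩

end Bases

/-! ### The kernel algebra and Lie symmetry extensions -/

theorem symEq_zero (I : Set ℝ) (h l : ℝ → ℝ) : SymEq I h l 0 0 0 := fun t _ => by simp

/-- One equation suffices: for h = e^t, l = 1 the condition on h gives c₁ = 0, c₀ = 2a, and that on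
l gives a = 0. -/
theorem mem_kernelAlgebra_iff {I : Set ℝ} (hI : IsOpenInterval I) (Γ : VectorField I) :
    Γ ∈ kernelAlgebra I ↔ ∃ b : ℝ, Γ = affineField I 0 0 0 b := by
  constructor
  · intro hΓ
    have hcl : InClass I Real.exp (fun _ => 1) :=
      ⟨hI, Real.contDiff_exp.contDiffOn, contDiffOn_const, fun t _ => Real.exp_ne_zero t⟩
    obtain ⟨c₁, c₀, a, b, hs, rfl⟩ := (mem_Amax_iff hI hcl.h_ne_zero Γ).1 (hΓ _ _ hcl)
    have e1 : ∀ t ∈ I, c₁ * t + (c₀ - 2 * a) = 0 := fun t ht => by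
      have e := (hs t ht).1
      rw [Real.deriv_exp] at e
      apply mul_left_cancel₀ (Real.exp_ne_zero t)
      linear_combination e
    obtain ⟨e2, e3⟩ := hI.affine_eq_zero e1
    obtain ⟨t, ht⟩ := hI.nonempty
    have e4 := (hs t ht).2
    rw [deriv_const] at e4
    subst e2
    have ha : a = 0 := by linarith
    subst ha
    have hc : c₀ = 0 := by linarith
    subst hc
    exact ⟨b, rfl⟩
  · rintro ⟨b, rfl⟩ h l hcl
    exact (mem_Amax_iff hI hcl.h_ne_zero _).2 ⟨0, 0, 0, b, symEq_zero _ _ _, rfl⟩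

theorem isBasisOf_kernelAlgebra {I : Set ℝ} (hI : IsOpenInterval I) :
    IsBasisOf ![fieldX I] (kernelAlgebra I) := by
  refine ⟨linearIndependent_fieldX hI, ?_⟩
  ext Γ
  have hb : ∀ b : ℝ, affineField I 0 0 0 b = b • fieldX I := fun b => by
    funext p; simp [affineField, fieldX]
  rw [mem_kernelAlgebra_iff hI, SetLike.mem_coe, Matrix.range_cons, Matrix.range_empty,
    Set.union_empty, Submodule.mem_span_singleton]
  simp only [hb, eq_comm]

/-- Only (c₁, c₀) matters: if it vanishes, 2ah = 0 and h ≠ 0 give a = 0, and the field lies in the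
kernel. -/
theorem hasExtension_iff {I : Set ℝ} {h l : ℝ → ℝ} (H : InClass I h l) :
    HasExtension I h l ↔ ∃ c₁ c₀ a : ℝ, (c₁, c₀) ≠ (0, 0) ∧ SymEq I h l c₁ c₀ a := by
  rw [HasExtension, Set.ssubset_def]
  constructor
  · rintro ⟨-, hn⟩
    obtain ⟨Γ, hΓ, hk⟩ := Set.not_subset.1 hn
    obtain ⟨c₁, c₀, a, b, hs, rfl⟩ := (mem_Amax_iff H.interval H.h_ne_zero Γ).1 hΓ
    refine ⟨c₁, c₀, a, fun e => hk ?_, hs⟩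
    obtain ⟨rfl, rfl⟩ := Prod.mk.inj e
    obtain ⟨t, ht⟩ := H.interval.nonempty
    have ha : a = 0 := by simpa [H.h_ne_zero t ht] using (hs t ht).1
    subst ha
    exact (mem_kernelAlgebra_iff H.interval _).2 ⟨b, rfl⟩
  · rintro ⟨c₁, c₀, a, hne, hs⟩
    refine ⟨fun Γ hΓ => hΓ h l H, fun hsub => hne ?_⟩
    obtain ⟨b, hb⟩ := (mem_kernelAlgebra_iff H.interval _).1
      (hsub ((mem_Amax_iff H.interval H.h_ne_zero _).2 ⟨c₁, c₀, a, 0, hs, rfl⟩))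
    have e : ∀ t ∈ I, c₁ * t + c₀ = 0 := fun t ht => by
      simpa [affineField] using congrArg Prod.fst (congrFun hb (⟨t, ht⟩, 0, 0))
    obtain ⟨rfl, rfl⟩ := H.interval.affine_eq_zero e
    rfl

/-! ### Action of the equivalence group -/

namespace EquivTransf

/-- The inverse transformation. -/
noncomputable def inv (g : EquivTransf) : EquivTransf where
  δ₀ := -(g.δ₀ * (g.δ₃ / g.δ₁))
  δ₁ := g.δ₁⁻¹
  δ₂ := -(g.δ₂ / g.δ₁)
  δ₃ := g.δ₃⁻¹
  δ₁_ne_zero := inv_ne_zero g.δ₁_ne_zero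
  δ₃_ne_zero := inv_ne_zero g.δ₃_ne_zero

theorem inv_mapT_mapT (g : EquivTransf) (t : ℝ) : g.inv.mapT (g.mapT t) = t := by
  have h1 := g.δ₁_ne_zero
  have h3 := g.δ₃_ne_zero
  simp only [mapT, inv]; field_simp; ring

theorem mapT_inv_mapT (g : EquivTransf) (t : ℝ) : g.mapT (g.inv.mapT t) = t := by
  have h1 := g.δ₁_ne_zero
  have h3 := g.δ₃_ne_zero
  simp only [mapT, inv]; field_simp; ring

theorem Maps.symm {g : EquivTransf} {I I' : Set ℝ} {h l h' l' : ℝ → ℝ}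
    (hg : g.Maps I h l I' h' l') : g.inv.Maps I' h' l' I h l := by
  obtain ⟨rfl, hv⟩ := hg
  refine ⟨?_, ?_⟩
  · rw [← Set.image_comp]
    simp [inv_mapT_mapT]
  · rintro _ ⟨t, ht, rfl⟩
    obtain ⟨e1, e2⟩ := hv t ht
    have h1 := g.δ₁_ne_zero
    have h3 := g.δ₃_ne_zero
    rw [inv_mapT_mapT, e1, e2]
    simp only [mapH, mapL, inv]
    constructor <;> field_simp

/-- Needed because `EquivalentToCase` does not require its target set to be an open interval. -/
theorem mapT_image_isOpenInterval (g : EquivTransf) {I : Set ℝ} (hI : IsOpenInterval I) :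
    IsOpenInterval (g.mapT '' I) := by
  have hc : ∀ g : EquivTransf, Continuous g.mapT := fun g => by
    unfold mapT; fun_prop
  refine ⟨?_, (hI.ordConnected.isPreconnected.image _ (hc g).continuousOn).ordConnected,
    hI.nonempty.image _⟩
  rw [Set.image_eq_preimage_of_inverse g.inv_mapT_mapT g.mapT_inv_mapT]
  exact hI.isOpen.preimage (hc _)

/-- The conditions are linear and homogeneous in h and l, so the constant factors drop out. The
affine change of t rescales τ and d/dt inversely, so c₁ and a persist and only c₀ moves. -/
theorem Maps.symEq {g : EquivTransf} {I I' : Set ℝ} {h l h' l' : ℝ → ℝ} (hI : IsOpen I)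
    (hg : g.Maps I h l I' h' l') {c₁ c₀ a : ℝ} (hs : SymEq I' h' l' c₁ c₀ a) :
    SymEq I h l c₁ ((c₁ * g.δ₀ + c₀) / (g.δ₁ / g.δ₃)) a := by
  obtain ⟨rfl, hv⟩ := hg
  have h1 := g.δ₁_ne_zero
  have h3 := g.δ₃_ne_zero
  have key : ∀ (k : ℝ) (w f : ℝ → ℝ), (∀ t ∈ I, f t = k * w (g.mapT t)) → ∀ t ∈ I,
      deriv f t = k * (g.δ₁ / g.δ₃ * deriv w (g.mapT t)) := fun k w f hf t ht => by
    have : f =ᶠ[nhds t] fun s => k * w (g.mapT s) := by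
      filter_upwards [hI.mem_nhds ht] with s hs using hf s hs
    rw [this.deriv_eq, deriv_const_mul_field']
    simp only [mapT]
    rw [deriv_comp_mul_left (g.δ₁ / g.δ₃) (fun z => w (z + g.δ₀)), deriv_comp_add_const,
      smul_eq_mul]
  have eh : ∀ t ∈ I, h t = (g.δ₁ ^ 2)⁻¹ * h' (g.mapT t) := fun t ht => by
    rw [(hv t ht).1, mapH]; field_simp
  have el : ∀ t ∈ I, l t = (g.δ₃ ^ 2 / g.δ₁)⁻¹ * l' (g.mapT t) := fun t ht => by
    rw [(hv t ht).2, mapL]; field_simp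
  intro t ht
  obtain ⟨e1, e2⟩ := hs _ ⟨t, ht, rfl⟩
  rw [key _ _ _ eh t ht, key _ _ _ el t ht, eh t ht, el t ht]
  have e3 : (c₁ * t + (c₁ * g.δ₀ + c₀) / (g.δ₁ / g.δ₃)) * (g.δ₁ / g.δ₃)
      = c₁ * g.mapT t + c₀ := by
    simp only [mapT]; field_simp; ring
  constructor
  · linear_combination (g.δ₁ ^ 2)⁻¹ * deriv h' (g.mapT t) * e3 + (g.δ₁ ^ 2)⁻¹ * e1
  · linear_combination (g.δ₃ ^ 2 / g.δ₁)⁻¹ * deriv l' (g.mapT t) * e3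
      + (g.δ₃ ^ 2 / g.δ₁)⁻¹ * e2

end EquivTransf

/-! ### Inequivalence of the cases -/

/-- There is a Lie symmetry with nonconstant coefficient of `∂_t`. -/
def HasScaling (I : Set ℝ) (h l : ℝ → ℝ) : Prop := ∃ c₁ c₀ a, c₁ ≠ 0 ∧ SymEq I h l c₁ c₀ a

/-- There is a Lie symmetry with constant nonzero coefficient of `∂_t`. -/
def HasShift (I : Set ℝ) (h l : ℝ → ℝ) : Prop := ∃ c₀ a, c₀ ≠ 0 ∧ SymEq I h l 0 c₀ a

/-- There is a Lie symmetry that scales `x` and has constant coefficient of `∂_t`. -/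
def HasScalingShift (I : Set ℝ) (h l : ℝ → ℝ) : Prop := ∃ c₀ a, a ≠ 0 ∧ SymEq I h l 0 c₀ a

theorem EquivTransf.Maps.invariants {g : EquivTransf} {I I' : Set ℝ} {h l h' l' : ℝ → ℝ}
    (hI : IsOpen I) (hg : g.Maps I h l I' h' l') :
    (HasScaling I' h' l' → HasScaling I h l) ∧ (HasShift I' h' l' → HasShift I h l) ∧
      (HasScalingShift I' h' l' → HasScalingShift I h l) := by
  refine ⟨?_, ?_, ?_⟩
  · rintro ⟨c₁, c₀, a, hne, hs⟩
    exact ⟨_, _, _, hne, hg.symEq hI hs⟩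
  · rintro ⟨c₀, a, hne, hs⟩
    refine ⟨_, _, ?_, hg.symEq hI hs⟩
    have h1 := g.δ₁_ne_zero
    have h3 := g.δ₃_ne_zero
    simp only [zero_mul, zero_add]
    positivity
  · rintro ⟨c₀, a, hne, hs⟩
    exact ⟨_, _, hne, hg.symEq hI hs⟩

/-- The cases are distinguished by the three invariants. -/
theorem invariants_of_inCase {I : Set ℝ} {h l : ℝ → ℝ} (hI : IsOpenInterval I) {k : Fin 4}
    (hk : InCase k I h l) :
    (HasScaling I h l ↔ k = 0 ∨ k = 3) ∧ (HasShift I h l ↔ k ≠ 0) ∧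
      (HasScalingShift I h l ↔ k = 1) := by
  match k, hk with
  | 0, ⟨ε, ρ, lam, hc⟩ =>
    simp only [HasScaling, HasShift, HasScalingShift, symEq_case1 hI hc]
    refine ⟨⟨by simp, fun _ => ⟨1, 0, ρ / 2, by norm_num, rfl, by ring⟩⟩, ?_, ?_⟩
    · simp
    · simp
  | 1, ⟨ε, lam, hc⟩ =>
    simp only [HasScaling, HasShift, HasScalingShift, symEq_case2 hI hc]
    refine ⟨by simp, ⟨by simp, fun _ => ⟨2, 1, by simp⟩⟩, ⟨by simp, fun _ => ⟨2, 1, by simp⟩⟩⟩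
  | 2, ⟨ε, hc⟩ =>
    simp only [HasScaling, HasShift, HasScalingShift, symEq_case3 hI hc]
    refine ⟨by simp, ⟨by simp, fun _ => ⟨1, 0, by simp⟩⟩, by simp⟩
  | 3, ⟨ε, hc⟩ =>
    simp only [HasScaling, HasShift, HasScalingShift, symEq_case4 hI hc]
    refine ⟨⟨by simp, fun _ => ⟨1, 0, 0, by simp⟩⟩, ⟨by simp, fun _ => ⟨1, 0, by simp⟩⟩, by simp⟩

/-- For (`HasScaling`, `HasShift`, `HasScalingShift`) Cases 1-4 have the patterns (+,-,-), (-,+,+),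
(-,+,-), (+,+,-), which are pairwise distinct. -/
theorem case_unique {I I' : Set ℝ} {h l h' l' : ℝ → ℝ} (hI : IsOpenInterval I)
    (hI' : IsOpenInterval I') {k k' : Fin 4} (hk : InCase k I h l) (hk' : InCase k' I' h' l')
    (he : Equivalent I h l I' h' l') : k = k' := by
  obtain ⟨g, hg⟩ := he
  obtain ⟨a1, a2, a3⟩ := hg.invariants hI.isOpen
  obtain ⟨b1, b2, b3⟩ := hg.symm.invariants hI'.isOpen
  obtain ⟨i1, i2, i3⟩ := invariants_of_inCase hI hk
  obtain ⟨j1, j2, j3⟩ := invariants_of_inCase hI' hk'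
  have e1 := i1.symm.trans ((⟨b1, a1⟩ : HasScaling I h l ↔ HasScaling I' h' l').trans j1)
  have e2 := i2.symm.trans ((⟨b2, a2⟩ : HasShift I h l ↔ HasShift I' h' l').trans j2)
  have e3 := i3.symm.trans
    ((⟨b3, a3⟩ : HasScalingShift I h l ↔ HasScalingShift I' h' l').trans j3)
  clear i1 i2 i3 j1 j2 j3 a1 a2 a3 b1 b2 b3 hk hk' hg
  fin_cases k <;> fin_cases k' <;> simp_all

/-! ### Classification of the equations with Lie symmetry extensions -/

/-- Equivalence to an equation of the classification list. -/
def EquivalentToCase (I : Set ℝ) (h l : ℝ → ℝ) : Prop :=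
  ∃ (I' : Set ℝ) (h' l' : ℝ → ℝ) (k : Fin 4), Equivalent I h l I' h' l' ∧ InCase k I' h' l'

theorem hasExtension_of_equivalentToCase {I : Set ℝ} {h l : ℝ → ℝ} (H : InClass I h l)
    (he : EquivalentToCase I h l) : HasExtension I h l := by
  obtain ⟨I', h', l', k, ⟨g, hg⟩, hk⟩ := he
  have hI' : IsOpenInterval I' := hg.1 ▸ g.mapT_image_isOpenInterval H.interval
  obtain ⟨i1, i2, -⟩ := hg.invariants H.interval.isOpen
  obtain ⟨j1, j2, -⟩ := invariants_of_inCase hI' hk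
  rw [hasExtension_iff H]
  rcases eq_or_ne k 0 with h0 | h0
  · obtain ⟨c₁, c₀, a, hne, hs⟩ := i1 (j1.2 (Or.inl h0))
    exact ⟨c₁, c₀, a, by simp [hne], hs⟩
  · obtain ⟨c₀, a, hne, hs⟩ := i2 (j2.2 h0)
    exact ⟨0, c₀, a, by simp [hne], hs⟩

/-! ### Normalization of the constants by equivalence transformations -/

theorem exists_normalizing_scale {C : ℝ} (hC : C ≠ 0) :
    ∃ d : ℝ, 0 < d ∧ (d ^ 2 * C = 1 ∨ d ^ 2 * C = -1) := by
  refine ⟨(Real.sqrt |C|)⁻¹, inv_pos.2 (Real.sqrt_pos.2 (abs_pos.2 hC)), ?_⟩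
  rw [inv_pow, Real.sq_sqrt (abs_nonneg C)]
  rcases lt_or_gt_of_ne hC with h | h
  · right; rw [abs_of_neg h]; field_simp
  · left; rw [abs_of_pos h]; field_simp

theorem equivalentToCase_of_const {I : Set ℝ} {h l : ℝ → ℝ} {C D : ℝ} (hC : C ≠ 0)
    (hv : ∀ t ∈ I, h t = C ∧ l t = D) : EquivalentToCase I h l := by
  obtain ⟨d, hd, hε⟩ := exists_normalizing_scale hC
  rcases eq_or_ne D 0 with rfl | hD
  · let g : EquivTransf := ⟨0, d, 0, 1, hd.ne', one_ne_zero⟩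
    refine ⟨_, fun _ => d ^ 2 * C, fun _ => 0, 3, ⟨g, rfl, fun t ht => ?_⟩, _, hε,
      fun _ _ => ⟨rfl, rfl⟩⟩
    rw [(hv t ht).1, (hv t ht).2]
    simp [EquivTransf.mapH, EquivTransf.mapL, g]
  -- Only δ₁² acts on h, so the sign of δ₁ = e may match that of D; then δ₃² = e/D makes l equal to
  -- 1.
  · obtain ⟨e, he, hq⟩ : ∃ e : ℝ, e ^ 2 = d ^ 2 ∧ 0 < e / D := by
      rcases lt_or_gt_of_ne hD with h | h
      · exact ⟨-d, by ring, div_pos_of_neg_of_neg (by linarith) h⟩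
      · exact ⟨d, rfl, div_pos hd h⟩
    have he0 : e ≠ 0 := fun h => by simp [h] at hq
    let g : EquivTransf := ⟨0, e, 0, Real.sqrt (e / D), he0, (Real.sqrt_pos.2 hq).ne'⟩
    refine ⟨_, fun _ => d ^ 2 * C, fun _ => 1, 2, ⟨g, rfl, fun t ht => ?_⟩, _, hε,
      fun _ _ => ⟨rfl, rfl⟩⟩
    rw [(hv t ht).1, (hv t ht).2]
    simp only [EquivTransf.mapH, EquivTransf.mapL, g, he, Real.sq_sqrt hq.le]
    refine ⟨trivial, ?_⟩
    field_simp

theorem equivalentToCase_of_exp {I : Set ℝ} {h l : ℝ → ℝ} {C D κ : ℝ} (hC : C ≠ 0) (hκ : κ ≠ 0)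
    (hv : ∀ t ∈ I, h t = C * Real.exp (2 * κ * t) ∧ l t = D * Real.exp (κ * t)) :
    EquivalentToCase I h l := by
  obtain ⟨d, hd, hε⟩ := exists_normalizing_scale hC
  have hd0 := hd.ne'
  -- δ₁/δ₃ = 2κ turns the exponent of h into the new time.
  let g : EquivTransf := ⟨0, d, 0, d / (2 * κ), hd0, by positivity⟩
  have hT : ∀ t, g.mapT t = 2 * κ * t := fun t => by
    simp only [EquivTransf.mapT, g]; field_simp; ring
  refine ⟨_, fun s => d ^ 2 * C * Real.exp s,
    fun s => (d / (2 * κ)) ^ 2 / d * D * Real.exp (s / 2), 1, ⟨g, rfl, fun t ht => ?_⟩, _, _, hε,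
      fun _ _ => ⟨rfl, rfl⟩⟩
  have h2 : 2 * κ * t / 2 = κ * t := by ring
  rw [(hv t ht).1, (hv t ht).2, hT]
  simp only [h2, EquivTransf.mapH, EquivTransf.mapL, g]
  constructor <;> ring

theorem equivalentToCase_of_power {I : Set ℝ} {h l : ℝ → ℝ} {C D κ c : ℝ} (hC : C ≠ 0)
    (hc : -c ∉ I) (hv : ∀ t ∈ I, h t = C * |t + c| ^ (2 * κ) ∧ l t = D * |t + c| ^ (κ - 2)) :
    EquivalentToCase I h l := by
  -- The pair excluded from Case 1; it belongs to Case 4.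
  by_cases h0 : κ = 0 ∧ D = 0
  · obtain ⟨rfl, rfl⟩ := h0
    exact equivalentToCase_of_const (D := 0) hC fun t ht => by
      rw [(hv t ht).1, (hv t ht).2]; simp
  obtain ⟨d, hd, hε⟩ := exists_normalizing_scale hC
  have hd0 := hd.ne'
  -- δ₁ = δ₃ makes the action on t a pure shift, moving the singular point -c to 0.
  let g : EquivTransf := ⟨c, d, 0, d, hd0, hd0⟩
  have hT : ∀ t, g.mapT t = t + c := fun t => by
    simp only [EquivTransf.mapT, g]; field_simp
  refine ⟨_, fun s => d ^ 2 * C * |s| ^ (2 * κ),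
    fun s => d * D * |s| ^ ((2 * κ - 4) / 2), 0, ⟨g, rfl, fun t ht => ?_⟩, _, _, _, hε,
      ?_, ?_, fun _ _ => ⟨rfl, rfl⟩⟩
  · have h2 : (2 * κ - 4) / 2 = κ - 2 := by ring
    rw [(hv t ht).1, (hv t ht).2, hT]
    simp only [h2, EquivTransf.mapH, EquivTransf.mapL, g]
    constructor
    · ring
    · field_simp
  · simpa [hd0] using h0
  · rintro ⟨t, ht, e⟩
    rw [hT] at e
    exact hc (by rwa [← eq_neg_of_add_eq_zero_left e])

/-! ### Integration of the first-order equations for h and l -/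

section Integration

variable {I : Set ℝ} {f : ℝ → ℝ} (hI : IsOpenInterval I) (hf : ContDiffOn ℝ ∞ f I)
include hI hf

theorem hasDerivAt_of_mem {t : ℝ} (ht : t ∈ I) : HasDerivAt f (deriv f t) t :=
  ((hf.contDiffAt (hI.isOpen.mem_nhds ht)).differentiableAt (by simp)).hasDerivAt

theorem eq_exp_of_deriv {r : ℝ} (hd : ∀ t ∈ I, deriv f t = r * f t) :
    ∃ C, ∀ t ∈ I, f t = C * Real.exp (r * t) := by
  obtain ⟨t₀, ht₀⟩ := hI.nonempty
  refine ⟨f t₀ * Real.exp (-r * t₀), fun t ht => ?_⟩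
  have := hI.eq_of_deriv_eq_zero (f := fun t => f t * Real.exp (-r * t)) (fun s hs => by
    have e := (hasDerivAt_of_mem hI hf hs).mul (((hasDerivAt_id s).const_mul (-r)).exp)
    rw [hd s hs] at e
    refine e.congr_deriv ?_
    ring) ht₀ ht
  rw [this, mul_assoc, ← Real.exp_add]
  simp

theorem eq_power_of_deriv {r c : ℝ} (hc : -c ∉ I) (hd : ∀ t ∈ I, (t + c) * deriv f t = r * f t) :
    ∃ C, ∀ t ∈ I, f t = C * |t + c| ^ r := by
  have hne : ∀ t ∈ I, t + c ≠ 0 := fun t ht e => hc (by rwa [← eq_neg_of_add_eq_zero_left e])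
  obtain ⟨t₀, ht₀⟩ := hI.nonempty
  refine ⟨f t₀ * |t₀ + c| ^ (-r), fun t ht => ?_⟩
  have := hI.eq_of_deriv_eq_zero (f := fun t => f t * |t + c| ^ (-r)) (fun s hs => by
    have e := (hasDerivAt_of_mem hI hf hs).mul
      ((hasDerivAt_abs_rpow (hne s hs) (-r)).comp_add_const s c)
    refine e.congr_deriv ?_
    have h1 := hne s hs
    field_simp
    linear_combination |s + c| ^ (-r) * hd s hs) ht₀ ht
  rw [this, mul_assoc, ← Real.rpow_add (abs_pos.2 (hne t ht))]
  simp

/-- At t = -c the hypothesis is void; there continuity of the derivative gives the value. -/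
theorem deriv_eq_zero_of_mul_eq_zero {c : ℝ} (hd : ∀ t ∈ I, (t + c) * deriv f t = 0) :
    ∀ t ∈ I, deriv f t = 0 := fun t ht => by
  by_cases h0 : t + c = 0
  · have hcont : ContinuousAt (deriv f) t :=
      ((hf.continuousOn_deriv_of_isOpen hI.isOpen (by simp)).continuousAt (hI.isOpen.mem_nhds ht))
    have hev : deriv f =ᶠ[nhdsWithin t {t}ᶜ] fun _ => 0 := by
      filter_upwards [self_mem_nhdsWithin, mem_nhdsWithin_of_mem_nhds (hI.isOpen.mem_nhds ht)]
        with s hs hsI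
      have : s + c ≠ 0 := fun e => hs (by
        rw [Set.mem_singleton_iff]; linarith)
      simpa [this] using hd s hsI
    have hlim : Filter.Tendsto (deriv f) (nhdsWithin t {t}ᶜ) (nhds (deriv f t)) :=
      hcont.tendsto.mono_left nhdsWithin_le_nhds
    exact tendsto_nhds_unique hlim (tendsto_const_nhds.congr' hev.symm)
  · simpa [h0] using hd t ht

end Integration

theorem equivalentToCase_of_symEq {I : Set ℝ} {h l : ℝ → ℝ} (H : InClass I h l) {c₁ c₀ a : ℝ}
    (hne : (c₁, c₀) ≠ (0, 0)) (hs : SymEq I h l c₁ c₀ a) : EquivalentToCase I h l := by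
  have hI := H.interval
  obtain ⟨t₀, ht₀⟩ := hI.nonempty
  rcases eq_or_ne c₁ 0 with rfl | hc₁
  · have hc₀ : c₀ ≠ 0 := fun e => hne (by rw [e])
    obtain ⟨C, hC⟩ := eq_exp_of_deriv hI H.smooth_h (r := 2 * (a / c₀)) fun t ht => by
      have := (hs t ht).1
      field_simp
      linear_combination this
    obtain ⟨D, hD⟩ := eq_exp_of_deriv hI H.smooth_l (r := a / c₀) fun t ht => by
      have := (hs t ht).2
      field_simp
      linear_combination this
    have hC0 : C ≠ 0 := fun e => H.h_ne_zero t₀ ht₀ (by rw [hC t₀ ht₀, e, zero_mul])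
    rcases eq_or_ne a 0 with rfl | ha
    · exact equivalentToCase_of_const (D := D) hC0 fun t ht => by
        rw [hC t ht, hD t ht]; simp
    · exact equivalentToCase_of_exp hC0 (div_ne_zero ha hc₀) fun t ht => ⟨hC t ht, hD t ht⟩
  · have eh : ∀ t ∈ I, (t + c₀ / c₁) * deriv h t = 2 * (a / c₁) * h t := fun t ht => by
      have := (hs t ht).1
      field_simp
      linear_combination this
    have el : ∀ t ∈ I, (t + c₀ / c₁) * deriv l t = (a / c₁ - 2) * l t := fun t ht => by
      have := (hs t ht).2
      field_simp
      linear_combination this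
    generalize a / c₁ = κ at eh el
    generalize c₀ / c₁ = c at eh el
    -- If τ vanishes inside `I`, evaluating the h-equation there gives κ = 0, so h' = 0. Moreover (t
    -- + c)²l is constant and zero at -c, while the l-equation at -c itself reads 0 = -2l; hence l =
    -- 0, and the equation falls under Case 4.
    by_cases hc : -c ∈ I
    · have hκ : κ = 0 := by simpa [H.h_ne_zero _ hc] using eh _ hc
      subst hκ
      have dh := deriv_eq_zero_of_mul_eq_zero hI H.smooth_h (c := c) fun t ht => by
        rw [eh t ht]; ring
      have hl : ∀ t ∈ I, l t = 0 := fun t ht => by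
        have e := hI.eq_of_deriv_eq_zero (f := fun t => (t + c) ^ 2 * l t) (fun s hs => by
          have e := (((hasDerivAt_id s).add_const c).pow 2).mul
            (hasDerivAt_of_mem hI H.smooth_l hs)
          refine e.congr_deriv ?_
          norm_num
          linear_combination (s + c) * el s hs) ht hc
        have e2 := el t ht
        by_cases h0 : t + c = 0
        · rw [h0] at e2; linarith
        · simpa [h0] using e
      refine equivalentToCase_of_const (D := 0) (H.h_ne_zero t₀ ht₀) fun t ht => ⟨?_, hl t ht⟩
      exact hI.eq_of_deriv_eq_zero (fun s hs => by
        have := hasDerivAt_of_mem hI H.smooth_h hs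
        rwa [dh s hs] at this) ht ht₀
    · obtain ⟨C, hC⟩ := eq_power_of_deriv hI H.smooth_h hc eh
      obtain ⟨D, hD⟩ := eq_power_of_deriv hI H.smooth_l hc el
      have hC0 : C ≠ 0 := fun e => H.h_ne_zero t₀ ht₀ (by rw [hC t₀ ht₀, e, zero_mul])
      exact equivalentToCase_of_power hC0 hc fun t ht => ⟨hC t ht, hD t ht⟩

theorem hasExtension_iff_equivalentToCase {I : Set ℝ} {h l : ℝ → ℝ} (H : InClass I h l) :
    HasExtension I h l ↔ EquivalentToCase I h l := by
  refine ⟨fun he => ?_, hasExtension_of_equivalentToCase H⟩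
  obtain ⟨c₁, c₀, a, hne, hs⟩ := (hasExtension_iff H).1 he
  exact equivalentToCase_of_symEq H hne hs

end BBM

theorem theorem5 :
    -- the kernel of the maximal Lie invariance algebras is the one-dimensional algebra `⟨∂_x⟩`
    (∀ I : Set ℝ, BBM.IsOpenInterval I →
      BBM.IsBasisOf ![BBM.fieldX I] (BBM.kernelAlgebra I)) ∧
    -- the equations with Lie symmetry extensions are, up to equivalence, those of Cases 1-4
    (∀ (I : Set ℝ) (h l : ℝ → ℝ), BBM.InClass I h l →
      (BBM.HasExtension I h l ↔
        ∃ (I' : Set ℝ) (h' l' : ℝ → ℝ) (k : Fin 4),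
          BBM.Equivalent I h l I' h' l' ∧ BBM.InCase k I' h' l')) ∧
    -- equations of different cases are inequivalent
    (∀ (I : Set ℝ) (h l : ℝ → ℝ) (I' : Set ℝ) (h' l' : ℝ → ℝ) (k k' : Fin 4),
      BBM.InClass I h l → BBM.InClass I' h' l' →
      BBM.InCase k I h l → BBM.InCase k' I' h' l' → BBM.Equivalent I h l I' h' l' → k = k') ∧
    -- the maximal Lie invariance algebras in Cases 1-4
    (∀ (I : Set ℝ) (h l : ℝ → ℝ), BBM.InClass I h l →
      (∀ ε ρ lam : ℝ, BBM.IsCase1 I h l ε ρ lam →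
        BBM.IsBasisOf ![BBM.fieldX I, BBM.fieldPower I ρ] (BBM.Amax I h l)) ∧
      (∀ ε lam : ℝ, BBM.IsCase2 I h l ε lam →
        BBM.IsBasisOf ![BBM.fieldX I, BBM.fieldExp I] (BBM.Amax I h l)) ∧
      (∀ ε : ℝ, BBM.IsCase3 I h l ε →
        BBM.IsBasisOf ![BBM.fieldX I, BBM.fieldT I] (BBM.Amax I h l)) ∧
      (∀ ε : ℝ, BBM.IsCase4 I h l ε →
        BBM.IsBasisOf ![BBM.fieldX I, BBM.fieldT I, BBM.fieldScale I] (BBM.Amax I h l))) := by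
  exact ⟨fun _ hI => BBM.isBasisOf_kernelAlgebra hI,
    fun _ _ _ H => BBM.hasExtension_iff_equivalentToCase H,
    fun _ _ _ _ _ _ _ _ H H' hk hk' he => BBM.case_unique H.interval H'.interval hk hk' he,
    fun _ _ _ H => ⟨fun _ _ _ hc => BBM.isBasisOf_case1 H hc,
      fun _ _ hc => BBM.isBasisOf_case2 H hc, fun _ hc => BBM.isBasisOf_case3 H hc,
      fun _ hc => BBM.isBasisOf_case4 H hc⟩⟩
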